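/- All graphs are finite and simple. A clique of a graph is an inclusion-wise maximal set of pairwise adjacent vertices; a biclique of a graph $G$ is an inclusion-wise maximal set $X$ of vertices such that $G[X]$ is a complete bipartite graph (with two nonempty parts). The edge-biclique hypergraph ${\cal EB}(G)$ has vertex set $E(G)$, and its hyperedges are the edge sets of the graphs $G[X]$, $X$ a biclique of $G$. The biclique line graph $L_G$ has vertex set $E(G)$, two distinct edges being adjacent if they belong to a common biclique; it is the 2-section of ${\cal EB}(G)$. The clique hypergraph of a graph $H$ has vertex set $V(H)$, and its hyperedges are the cliques of $H$. A hypergraph is Helly if every nonempty collection ${\cal F}$ of its hyperedges with $X\cap Y\neq\emptyset$ for all $X,Y\in{\cal F}$ satisfies $\bigcap_{X\in{\cal F}}X\neq\emptyset$. A graph is clique-Helly if its clique hypergraph is Helly. **Corollary.** Graphs whose edge-biclique hypergraph is Helly can be recognized in polynomial time, namely in time $O(|E(G)|^4)$, by building $L_G$ and testing whether it is clique-Helly. Precisely, on the unit-cost random access machine with words of $O(\log (s+2))$ bits, $s$ being the size of the input (number of vertices plus number of edges, the graph $G$ being given by a list of its edges, and all memory outside the input being initially zero), there are programs $A$ and $B$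 and a constant $C$ such that: 1. for every graph $G$, the program "first $A$, then $B$" started on $G$ stops after at most $C(|E(G)|^4+1)$ steps and answers whether ${\cal EB}(G)$ is Helly; 2. for every graph $G$, the program $A$ started on $G$ stops after at most $C(|E(G)|^2+1)$ steps with the adjacency matrix of $L_G$ in memory; 3. for every graph $H$ on $N$ vertices, the program $B$ started on the adjacency matrix of $H$ (whatever else the memory contains, and with words of $O(\log (N+2))$ bits) stops after at most $C(N^4+1)$ steps and answers whether $H$ is clique-Helly. -/

import Mathlib

/-! ### Hypergraphs, bicliques and the biclique line graph -/

/-- A hypergraph is Helly if every (nonempty) collection of hyperedges that intersect pairwise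
(`X` and `Y` may coincide) has a common element. -/
def Hypergraph.IsHelly {α : Type*} (H : Hypergraph α) : Prop :=
  ∀ F : Set (Set α), F ⊆ H.edgeSet → F.Nonempty →
    (∀ X ∈ F, ∀ Y ∈ F, (X ∩ Y).Nonempty) → (⋂₀ F).Nonempty

/-- The 2-section of a hypergraph: distinct vertices are adjacent if they lie in a common
hyperedge. -/
def Hypergraph.twoSection {α : Type*} (H : Hypergraph α) : SimpleGraph H.vertexSet where
  Adj x y := x ≠ y ∧ H.Adj x.1 y.1
  symm := ⟨fun _ _ h => ⟨h.1.symm, h.2.symm⟩⟩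
  loopless := ⟨fun _ h => h.1 rfl⟩

namespace SimpleGraph

variable {V : Type*}

/-- The clique hypergraph `K(G)`: its hyperedges are the inclusion-wise maximal sets of pairwise
adjacent vertices. -/
def cliqueHypergraph (G : SimpleGraph V) : Hypergraph V where
  vertexSet := Set.univ
  edgeSet := {X | Maximal G.IsClique X}
  subset_vertexSet_of_mem_edgeSet' := fun X _ => Set.subset_univ X

/-- `G[X]` is a complete bipartite graph: `X` splits into two nonempty parts, and two vertices of
`X` are adjacent exactly if they lie in different parts. -/
def InducesCompleteBipartite (G : SimpleGraph V) (X : Set V) : Prop :=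
  ∃ S T : Set V, S.Nonempty ∧ T.Nonempty ∧ Disjoint S T ∧ S ∪ T = X ∧
    ∀ u ∈ X, ∀ v ∈ X, (G.Adj u v ↔ (u ∈ S ∧ v ∈ T) ∨ (u ∈ T ∧ v ∈ S))

/-- A biclique is an inclusion-wise maximal vertex set inducing a complete bipartite graph. -/
def IsBiclique (G : SimpleGraph V) (X : Set V) : Prop :=
  Maximal G.InducesCompleteBipartite X

/-- The edge set of the induced subgraph `G[X]`, as a set of edges of `G`. -/
def edgesInside (G : SimpleGraph V) (X : Set V) : Set (Sym2 V) :=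
  {e | e ∈ G.edgeSet ∧ ∀ v ∈ e, v ∈ X}

/-- The edge-biclique hypergraph `EB(G)`: its vertices are the edges of `G`, its hyperedges are
the edge sets of the bicliques of `G`. -/
def edgeBicliqueHypergraph (G : SimpleGraph V) : Hypergraph (Sym2 V) where
  vertexSet := G.edgeSet
  edgeSet := {F | ∃ X, G.IsBiclique X ∧ F = G.edgesInside X}
  subset_vertexSet_of_mem_edgeSet' := by
    rintro _ ⟨X, _, rfl⟩ e he
    exact he.1

/-- The biclique line graph `L_G`: its vertices are the edges of `G`; two of them are adjacent if
they belong to a common biclique. -/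
def bicliqueLineGraph (G : SimpleGraph V) : SimpleGraph G.edgeSet :=
  G.edgeBicliqueHypergraph.twoSection

end SimpleGraph

/-! ### A unit-cost random access machine with bounded words -/

namespace RAM

/-- A machine state: registers, and finitely many (those a program mentions) random access
arrays of natural numbers. -/
structure State where
  reg : ℕ → ℕ
  arr : ℕ → ℕ → ℕ

/-- Write the value `v` to register `x`. -/
def State.setReg (s : State) (x v : ℕ) : State :=
  { s with reg := Function.update s.reg x v }

/-- Write the value `v` to cell `i` of array `a`. -/
def State.setCell (s : State) (a i v : ℕ) : State :=
  { s with arr := Function.update s.arr a (Function.update (s.arr a) i v) }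

/-- Programs. Register and array names are fixed in the program text; only the cell of an array
that is accessed is computed. -/
inductive Prog where
  /-- `reg x := c` -/
  | const (x c : ℕ)
  /-- `reg x := reg y + reg z` -/
  | add (x y z : ℕ)
  /-- `reg x := reg y - reg z`, truncated at zero -/
  | sub (x y z : ℕ)
  /-- `reg x := reg y * reg z` -/
  | mul (x y z : ℕ)
  /-- `reg x := arr a (reg y)` -/
  | load (x a y : ℕ)
  /-- `arr a (reg x) := reg y` -/
  | store (a x y : ℕ)
  /-- do nothing -/
  | skip
  /-- first `p`, then `q` -/
  | seq (p q : Prog)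
  /-- if `reg x < reg y` then `p` else `q` -/
  | ifLt (x y : ℕ) (p q : Prog)
  /-- while `reg x < reg y` do `p` -/
  | whileLt (x y : ℕ) (p : Prog)

/-- `Exec B p s t s'`: the program `p`, started in the state `s` on a machine whose words hold the
numbers below `B`, stops after exactly `t` steps in the state `s'`. Every basic instruction and
every evaluation of a test is one step. An instruction whose result does not fit into a word
cannot be executed, so a computation that overflows does not stop in the sense of this relation. -/
inductive Exec (B : ℕ) : Prog → State → ℕ → State → Prop where
  | const {s : State} {x c : ℕ} (h : c < B) :
      Exec B (.const x c) s 1 (s.setReg x c)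
  | add {s : State} {x y z : ℕ} (h : s.reg y + s.reg z < B) :
      Exec B (.add x y z) s 1 (s.setReg x (s.reg y + s.reg z))
  | sub {s : State} {x y z : ℕ} (h : s.reg y - s.reg z < B) :
      Exec B (.sub x y z) s 1 (s.setReg x (s.reg y - s.reg z))
  | mul {s : State} {x y z : ℕ} (h : s.reg y * s.reg z < B) :
      Exec B (.mul x y z) s 1 (s.setReg x (s.reg y * s.reg z))
  | load {s : State} {x a y : ℕ} (h : s.arr a (s.reg y) < B) :
      Exec B (.load x a y) s 1 (s.setReg x (s.arr a (s.reg y)))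
  | store {s : State} {a x y : ℕ} (hx : s.reg x < B) (hy : s.reg y < B) :
      Exec B (.store a x y) s 1 (s.setCell a (s.reg x) (s.reg y))
  | skip {s : State} : Exec B .skip s 1 s
  | seq {s s₁ s₂ : State} {p q : Prog} {t₁ t₂ : ℕ}
      (h₁ : Exec B p s t₁ s₁) (h₂ : Exec B q s₁ t₂ s₂) :
      Exec B (.seq p q) s (t₁ + t₂) s₂
  | if_pos {s s₁ : State} {x y : ℕ} {p q : Prog} {t : ℕ}
      (hlt : s.reg x < s.reg y) (h : Exec B p s t s₁) :
      Exec B (.ifLt x y p q) s (t + 1) s₁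
  | if_neg {s s₁ : State} {x y : ℕ} {p q : Prog} {t : ℕ}
      (hlt : ¬ s.reg x < s.reg y) (h : Exec B q s t s₁) :
      Exec B (.ifLt x y p q) s (t + 1) s₁
  | while_done {s : State} {x y : ℕ} {p : Prog} (hlt : ¬ s.reg x < s.reg y) :
      Exec B (.whileLt x y p) s 1 s
  | while_step {s s₁ s₂ : State} {x y : ℕ} {p : Prog} {t₁ t₂ : ℕ}
      (hlt : s.reg x < s.reg y) (h₁ : Exec B p s t₁ s₁)
      (h₂ : Exec B (.whileLt x y p) s₁ t₂ s₂) :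
      Exec B (.whileLt x y p) s (t₁ + t₂ + 1) s₂

/-- A listing `e₀, …, eₘ₋₁` of all edges of a graph on the vertices `0, …, n - 1`, without
repetition, each edge being given by its two ends in some order. -/
structure EdgeList {n : ℕ} (G : SimpleGraph (Fin n)) (m : ℕ) where
  fst : Fin m → Fin n
  snd : Fin m → Fin n
  adj : ∀ i, G.Adj (fst i) (snd i)
  bijective : Function.Bijective
    (fun i => (⟨s(fst i, snd i), adj i⟩ : G.edgeSet))

/-- The `i`-th edge of a listing. -/
def EdgeList.edge {n m : ℕ} {G : SimpleGraph (Fin n)} (L : EdgeList G m) (i : Fin m) :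
    G.edgeSet :=
  ⟨s(L.fst i, L.snd i), L.adj i⟩

/-- The start state for a graph given by an edge list: register `0` holds the number of vertices,
register `1` the number of edges, cell `i` of the arrays `0` and `1` the two ends of the `i`-th
edge; everything else is zero. -/
def EdgeList.input {n m : ℕ} {G : SimpleGraph (Fin n)} (L : EdgeList G m) : State where
  reg x := if x = 0 then n else if x = 1 then m else 0
  arr a i :=
    if h : i < m then
      if a = 0 then (L.fst ⟨i, h⟩ : ℕ) else if a = 1 then (L.snd ⟨i, h⟩ : ℕ) else 0
    else 0

open Classical in
/-- The state `s` holds the graph `H` on the vertices `0, …, N - 1`: register `0` holds `N`, and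
array `2` starts with the adjacency matrix of `H`, row by row. All other registers and cells are
arbitrary. -/
def HoldsGraph {N : ℕ} (H : SimpleGraph (Fin N)) (s : State) : Prop :=
  s.reg 0 = N ∧ ∀ i j : Fin N, s.arr 2 (i * N + j) = if H.Adj i j then 1 else 0

/-- The answer in register `0` is `1` if `P` holds and `0` if it does not. -/
def Answers (s : State) (P : Prop) : Prop :=
  (P → s.reg 0 = 1) ∧ (¬ P → s.reg 0 = 0)

end RAM

/-! Both Helly properties reduce to one condition on a binary relation. By Berge's criterion,
`isHelly_of_edgesThroughTwo`, a finite hypergraph is Helly if, for any three points that pairwise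
share hyperedges, all hyperedges through at least two of them have a common point. Suppose that
three such points always lie in one hyperedge, and that a point sharing a hyperedge with every point
of a hyperedge `E` belongs to `E`. Then the criterion turns into `TriangleHelly` for the relation
"in a common hyperedge".

Clique hypergraphs have both features. The hypergraph `EB(G)` may fail them, because three edges can
lie pairwise in bicliques whose sides do not fit together (`TwistedTriple`). In that case the three
bicliques contain the edges of a triangle, and no edge shares a biclique with all three edges of a
triangle. So a twisted triple refutes the Helly property and `TriangleHelly` alike. Without twisted
triples, edges that pairwise share bicliques lie in one biclique
(`exists_biclique_of_pairwise_adj`), and both features hold. As `EB(G)` and the clique hypergraph of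
`L_G` define the same relation on edges, they are Helly together.

For the running time, two edges share a biclique depending only on the four adjacencies between
their ends, so `L_G` takes constant time per pair. To test `TriangleHelly` on `N` elements, a table
of all `(a, b, u)` such that some `w` is related to `a` and `b` but not to `u` is filled by `N ^ 3`
searches of length `N`. Then each candidate `u` for each triangle needs three lookups. No loop runs
over the vertices of `G`, so the bounds involve the number of edges only. -/

/-! ### The triangle criterion and the Helly property of finite hypergraphs -/

/-- Every three pairwise related elements have an element to which everything that is related to
two of them is related. -/
def TriangleHelly {α : Type*} (r : α → α → Prop) : Prop :=
  ∀ a b c, r a b → r b c → r a c →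
    ∃ u, ∀ w, (r w a ∧ r w b ∨ r w b ∧ r w c ∨ r w a ∧ r w c) → r w u

/-- An element not related to itself is related to nothing, so only the range of `f` matters. This
passes from all of `Sym2` to the listed edges, and from `ℕ` to `Fin N`. -/
theorem triangleHelly_onFun_iff {α β : Type*} {r : α → α → Prop} (f : β → α)
    (hsymm : ∀ a b, r a b → r b a) (hrefl : ∀ a b, r a b → r a a)
    (hf : ∀ a, r a a → ∃ i, f i = a) :
    TriangleHelly (fun i j => r (f i) (f j)) ↔ TriangleHelly r := by
  constructor
  · intro h a b c hab hbc hac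
    obtain ⟨i, rfl⟩ := hf a (hrefl _ _ hab)
    obtain ⟨j, rfl⟩ := hf b (hrefl _ _ hbc)
    obtain ⟨k, rfl⟩ := hf c (hrefl _ _ (hsymm _ _ hbc))
    obtain ⟨u, hu⟩ := h i j k hab hbc hac
    refine ⟨f u, fun w hw => ?_⟩
    have hww : r w w := by
      rcases hw with hw | hw | hw <;> exact hrefl _ _ hw.1
    obtain ⟨l, rfl⟩ := hf w hww
    exact hu l hw
  · intro h i j k hij hjk hik
    obtain ⟨u, hu⟩ := h _ _ _ hij hjk hik
    -- Taking `w = f i` shows that `u` is related to something, hence lies in the range of `f`.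
    have hiu : r (f i) u := hu _ (Or.inl ⟨hrefl _ _ hij, hij⟩)
    obtain ⟨l, rfl⟩ := hf u (hrefl _ _ (hsymm _ _ hiu))
    exact ⟨l, fun w hw => hu _ hw⟩

namespace Hypergraph

variable {α : Type*}

/-- The hyperedges containing at least two of `a`, `b`, `c`. -/
def edgesThroughTwo (H : Hypergraph α) (a b c : α) : Set (Set α) :=
  {E | E ∈ H.edgeSet ∧ (a ∈ E ∧ b ∈ E ∨ b ∈ E ∧ c ∈ E ∨ a ∈ E ∧ c ∈ E)}

/-- Berge's criterion for the Helly property of a finite hypergraph. -/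
theorem isHelly_of_edgesThroughTwo [Finite α] (H : Hypergraph α)
    (h : ∀ a b c, H.Adj a b → H.Adj b c → H.Adj a c →
      (⋂₀ H.edgesThroughTwo a b c).Nonempty) : H.IsHelly := by
  classical
  intro F hF hne hint
  -- Induction on the size of a finite subfamily; sizes one and two are the assumption of pairwise
  -- intersection.
  have key : ∀ n : ℕ, ∀ S : Finset (Set α), S.card = n → (S : Set (Set α)) ⊆ F → S.Nonempty →
      (⋂₀ (S : Set (Set α))).Nonempty := by
    intro n
    induction n using Nat.strong_induction_on with
    | _ n ih =>
      intro S hn hS hSne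
      by_cases h3 : 2 < S.card
      · obtain ⟨A, hA, B, hB, C, hC, hAB, hAC, hBC⟩ := Finset.two_lt_card.1 h3
        have step : ∀ X ∈ S, (⋂₀ ((S.erase X : Finset (Set α)) : Set (Set α))).Nonempty := by
          intro X hX
          have hc := Finset.card_erase_of_mem hX
          refine ih _ (by omega) _ rfl ?_ ?_
          · exact fun Y hY => hS (Finset.mem_of_mem_erase hY)
          · rw [← Finset.card_pos]; omega
        obtain ⟨a, ha⟩ := step A hA
        obtain ⟨b, hb⟩ := step B hB
        obtain ⟨c, hc⟩ := step C hC
        have ha' : ∀ Y ∈ S, Y ≠ A → a ∈ Y := fun Y hY hne =>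
          ha Y (Finset.mem_coe.2 (Finset.mem_erase.2 ⟨hne, hY⟩))
        have hb' : ∀ Y ∈ S, Y ≠ B → b ∈ Y := fun Y hY hne =>
          hb Y (Finset.mem_coe.2 (Finset.mem_erase.2 ⟨hne, hY⟩))
        have hc' : ∀ Y ∈ S, Y ≠ C → c ∈ Y := fun Y hY hne =>
          hc Y (Finset.mem_coe.2 (Finset.mem_erase.2 ⟨hne, hY⟩))
        -- The points `a`, `b`, `c` lie in all members except possibly `A`, `B`, `C` respectively.
        -- So each two of them share one of these three sets, and every member contains at least two
        -- of them.
        obtain ⟨u, hu⟩ := h a b c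
          ⟨C, hF (hS hC), ha' C hC hAC.symm, hb' C hC hBC.symm⟩
          ⟨A, hF (hS hA), hb' A hA hAB, hc' A hA hAC⟩
          ⟨B, hF (hS hB), ha' B hB hAB.symm, hc' B hB hBC⟩
        refine ⟨u, fun E hE => hu E ⟨hF (hS hE), ?_⟩⟩
        have hE' : E ∈ S := hE
        by_cases hEA : E = A
        · subst hEA
          exact Or.inr (Or.inl ⟨hb' _ hE' hAB, hc' _ hE' hAC⟩)
        · by_cases hEB : E = B
          · subst hEB
            exact Or.inr (Or.inr ⟨ha' _ hE' hEA, hc' _ hE' hBC⟩)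
          · exact Or.inl ⟨ha' _ hE' hEA, hb' _ hE' hEB⟩
      · have hpos : 0 < S.card := Finset.card_pos.2 hSne
        obtain h1 | h2 : S.card = 1 ∨ S.card = 2 := by omega
        · obtain ⟨X, rfl⟩ := Finset.card_eq_one.1 h1
          obtain ⟨x, hx⟩ := hint X (hS (by simp)) X (hS (by simp))
          exact ⟨x, by simpa using hx⟩
        · obtain ⟨X, Y, -, rfl⟩ := Finset.card_eq_two.1 h2
          obtain ⟨x, hx⟩ := hint X (hS (by simp)) Y (hS (by simp))
          exact ⟨x, by simpa using hx⟩
  have hfin := Set.toFinite F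
  have := key _ hfin.toFinset rfl (by simp) (by simpa using hne)
  simpa using this

/-- Two sets that each contain two of three points share one of the points, so the family intersects
pairwise; `hab` only makes it nonempty. -/
theorem IsHelly.edgesThroughTwo_nonempty {H : Hypergraph α} (h : H.IsHelly) {a b c : α}
    (hab : H.Adj a b) : (⋂₀ H.edgesThroughTwo a b c).Nonempty := by
  obtain ⟨E, hE, haE, hbE⟩ := hab
  refine h _ (fun X hX => hX.1) ⟨E, hE, Or.inl ⟨haE, hbE⟩⟩ ?_
  rintro X ⟨-, hX⟩ Y ⟨-, hY⟩
  have : (a ∈ X ∧ a ∈ Y) ∨ (b ∈ X ∧ b ∈ Y) ∨ (c ∈ X ∧ c ∈ Y) := by tauto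
  rcases this with h | h | h <;> exact ⟨_, h⟩

/-- If every three pairwise adjacent vertices lie in a common hyperedge, then the Helly property
gives the triangle criterion. -/
theorem IsHelly.triangleHelly {H : Hypergraph α} (h : H.IsHelly)
    (hconf : ∀ a b c, H.Adj a b → H.Adj b c → H.Adj a c →
      ∃ E ∈ H.edgeSet, a ∈ E ∧ b ∈ E ∧ c ∈ E) : TriangleHelly H.Adj := by
  intro a b c hab hbc hac
  obtain ⟨u, hu⟩ := h.edgesThroughTwo_nonempty (c := c) hab
  refine ⟨u, fun w hw => ?_⟩
  rcases hw with ⟨h1, h2⟩ | ⟨h1, h2⟩ | ⟨h1, h2⟩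
  · obtain ⟨E, hE, hw, hx, hy⟩ := hconf w a b h1 hab h2
    exact ⟨E, hE, hw, hu E ⟨hE, Or.inl ⟨hx, hy⟩⟩⟩
  · obtain ⟨E, hE, hw, hx, hy⟩ := hconf w b c h1 hbc h2
    exact ⟨E, hE, hw, hu E ⟨hE, Or.inr (Or.inl ⟨hx, hy⟩)⟩⟩
  · obtain ⟨E, hE, hw, hx, hy⟩ := hconf w a c h1 hac h2
    exact ⟨E, hE, hw, hu E ⟨hE, Or.inr (Or.inr ⟨hx, hy⟩)⟩⟩

/-- If a vertex adjacent to all vertices of a hyperedge belongs to it, then the triangle criterion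
gives the Helly property. -/
theorem isHelly_of_triangleHelly [Finite α] {H : Hypergraph α} (h : TriangleHelly H.Adj)
    (hmax : ∀ E ∈ H.edgeSet, ∀ u, (∀ w ∈ E, H.Adj w u) → u ∈ E) : H.IsHelly := by
  refine H.isHelly_of_edgesThroughTwo fun a b c hab hbc hac => ?_
  obtain ⟨u, hu⟩ := h a b c hab hbc hac
  refine ⟨u, ?_⟩
  rintro E ⟨hE, hE2⟩
  -- Each `w` in `E` shares `E` itself with two of `a`, `b`, `c`, hence is adjacent to `u`.
  refine hmax E hE u fun w hw => hu w ?_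
  rcases hE2 with ⟨h1, h2⟩ | ⟨h1, h2⟩ | ⟨h1, h2⟩
  · exact Or.inl ⟨⟨E, hE, hw, h1⟩, ⟨E, hE, hw, h2⟩⟩
  · exact Or.inr (Or.inl ⟨⟨E, hE, hw, h1⟩, ⟨E, hE, hw, h2⟩⟩)
  · exact Or.inr (Or.inr ⟨⟨E, hE, hw, h1⟩, ⟨E, hE, hw, h2⟩⟩)

end Hypergraph

/-! ### Clique hypergraphs and edge-biclique hypergraphs -/

namespace SimpleGraph

variable {V : Type*}

theorem IsClique.exists_cliqueHypergraph_edge [Finite V] {G : SimpleGraph V} {X : Set V}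
    (h : G.IsClique X) : ∃ E ∈ G.cliqueHypergraph.edgeSet, X ⊆ E := by
  obtain ⟨E, hXE, hE⟩ := Finite.exists_le_maximal h
  exact ⟨E, hE, hXE⟩

theorem cliqueHypergraph_adj_iff [Finite V] (G : SimpleGraph V) (a b : V) :
    G.cliqueHypergraph.Adj a b ↔ a = b ∨ G.Adj a b := by
  constructor
  · rintro ⟨E, hE, ha, hb⟩
    by_cases hab : a = b
    · exact Or.inl hab
    · exact Or.inr (Maximal.prop hE ha hb hab)
  · intro h
    obtain ⟨E, hE, hXE⟩ := IsClique.exists_cliqueHypergraph_edge (G := G) (X := {a, b})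
      (by rcases h with rfl | h <;> simp [*])
    exact ⟨E, hE, hXE (by simp), hXE (by simp)⟩

/-- Pairwise adjacent triples extend to cliques, and a clique contains every vertex adjacent to all
its other vertices. So both auxiliary hypotheses hold for every finite graph. -/
theorem cliqueHypergraph_isHelly_iff [Finite V] (G : SimpleGraph V) :
    G.cliqueHypergraph.IsHelly ↔ TriangleHelly (fun a b => a = b ∨ G.Adj a b) := by
  have hadj : G.cliqueHypergraph.Adj = fun a b => a = b ∨ G.Adj a b := by
    funext a b
    exact propext (G.cliqueHypergraph_adj_iff a b)
  rw [← hadj]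
  constructor
  · intro h
    refine h.triangleHelly fun a b c hab hbc hac => ?_
    rw [cliqueHypergraph_adj_iff] at hab hbc hac
    obtain ⟨E, hE, hXE⟩ := IsClique.exists_cliqueHypergraph_edge (G := G) (X := {a, b, c}) (by
      intro x hx y hy hxy
      simp only [Set.mem_insert_iff, Set.mem_singleton_iff] at hx hy
      rcases hx with rfl | rfl | rfl <;> rcases hy with rfl | rfl | rfl <;>
        grind [SimpleGraph.adj_comm])
    exact ⟨E, hE, hXE (by simp), hXE (by simp), hXE (by simp)⟩
  · intro h
    refine Hypergraph.isHelly_of_triangleHelly h fun E hE u hu => ?_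
    have hE' : Maximal G.IsClique E := hE
    refine hE'.le_of_ge (y := insert u E) ?_ (Set.subset_insert u E) (Set.mem_insert u E)
    rw [isClique_insert]
    refine ⟨hE'.prop, fun w hw huw => ?_⟩
    have := (G.cliqueHypergraph_adj_iff w u).1 (hu w hw)
    exact (this.resolve_left huw.symm).symm

/-! ### Edges in a common biclique -/

/-- The edges `pq` and `xy` lie in a common complete bipartite subgraph, `p` and `x` on the same
side. -/
def Aligned (G : SimpleGraph V) (p q x y : V) : Prop :=
  G.Adj p y ∧ G.Adj q x ∧ ¬ G.Adj p x ∧ ¬ G.Adj q y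

theorem InducesCompleteBipartite.exists_biclique [Finite V] {G : SimpleGraph V} {X : Set V}
    (h : G.InducesCompleteBipartite X) :
    ∃ Y, G.IsBiclique Y ∧ X ⊆ Y := by
  obtain ⟨E, hXE, hE⟩ := Finite.exists_le_maximal h
  exact ⟨E, hE, hXE⟩

theorem inducesCompleteBipartite_union {G : SimpleGraph V} {S T : Set V}
    (hS : S.Nonempty) (hT : T.Nonempty) (hSS : ∀ u ∈ S, ∀ v ∈ S, ¬ G.Adj u v)
    (hTT : ∀ u ∈ T, ∀ v ∈ T, ¬ G.Adj u v) (hST : ∀ u ∈ S, ∀ v ∈ T, G.Adj u v) :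
    G.InducesCompleteBipartite (S ∪ T) := by
  refine ⟨S, T, hS, hT, ?_, rfl, ?_⟩
  · rw [Set.disjoint_left]
    intro a ha hb
    exact G.loopless.irrefl a (hST a ha a hb)
  · have hTS : ∀ u ∈ T, ∀ v ∈ S, G.Adj u v := fun u hu v hv => (hST v hv u hu).symm
    rintro u (hu | hu) v (hv | hv)
    · exact iff_of_false (hSS u hu v hv) (by grind)
    · exact iff_of_true (hST u hu v hv) (Or.inl ⟨hu, hv⟩)
    · exact iff_of_true (hTS u hu v hv) (Or.inr ⟨hu, hv⟩)
    · exact iff_of_false (hTT u hu v hv) (by grind)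

/-- The sides are `{p, x}` and `{q, y}`. The cross edge `qx` is recorded because three such cross
edges will form the triangle of a twisted triple. -/
theorem Aligned.exists_edge [Finite V] {G : SimpleGraph V} {p q x y : V}
    (h : G.Aligned p q x y) (hpq : G.Adj p q) (hxy : G.Adj x y) :
    ∃ E ∈ G.edgeBicliqueHypergraph.edgeSet, s(p, q) ∈ E ∧ s(x, y) ∈ E ∧ s(q, x) ∈ E := by
  obtain ⟨hpy, hqx, hpx, hqy⟩ := h
  have hpx' : ¬ G.Adj x p := fun h => hpx h.symm
  have hqy' : ¬ G.Adj y q := fun h => hqy h.symm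
  obtain ⟨Y, hY, hsub⟩ := (inducesCompleteBipartite_union (G := G) (S := {p, x}) (T := {q, y})
    (by simp) (by simp) (by simp [*]) (by simp [*])
    (by simp [hpq, hpy, hxy, hqx.symm])).exists_biclique
  refine ⟨_, ⟨Y, hY, rfl⟩, ⟨hpq, ?_⟩, ⟨hxy, ?_⟩, ⟨hqx, ?_⟩⟩ <;>
  · intro v hv
    apply hsub
    simp only [Sym2.mem_iff] at hv
    rcases hv with rfl | rfl <;> simp

/-- The edge `pq` fixes the two sides, and `xy` can be placed in two ways. Since the condition
involves just four adjacencies, it can be evaluated in constant time. -/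
theorem edgeBicliqueHypergraph_adj_mk_iff [Finite V] (G : SimpleGraph V) {p q x y : V}
    (hpq : G.Adj p q) (hxy : G.Adj x y) :
    G.edgeBicliqueHypergraph.Adj s(p, q) s(x, y) ↔ G.Aligned p q x y ∨ G.Aligned p q y x := by
  constructor
  · rintro ⟨_, ⟨X, hX, rfl⟩, ⟨-, h1⟩, ⟨-, h2⟩⟩
    obtain ⟨S, T, -, -, hd, -, h⟩ := hX.prop
    rw [Set.disjoint_left] at hd
    simp only [Sym2.mem_iff, forall_eq_or_imp, forall_eq] at h1 h2
    have e3 := h p h1.1 x h2.1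
    have e4 := h p h1.1 y h2.2
    have e5 := h q h1.2 x h2.1
    have e6 := h q h1.2 y h2.2
    have hp := @hd p
    have hq := @hd q
    have hx := @hd x
    have hy := @hd y
    unfold Aligned
    rw [e3, e4, e5, e6]
    rcases (h p h1.1 q h1.2).1 hpq with ⟨a, b⟩ | ⟨a, b⟩ <;>
      rcases (h x h2.1 y h2.2).1 hxy with ⟨c, d⟩ | ⟨c, d⟩ <;> grind
  · rintro (h | h)
    · obtain ⟨E, hE, h1, h2, -⟩ := h.exists_edge hpq hxy
      exact ⟨E, hE, h1, h2⟩
    · obtain ⟨E, hE, h1, h2, -⟩ := h.exists_edge hpq hxy.symm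
      exact ⟨E, hE, h1, by rwa [Sym2.eq_swap]⟩

theorem edgeBicliqueHypergraph_adj_mem {G : SimpleGraph V} {e f : Sym2 V}
    (h : G.edgeBicliqueHypergraph.Adj e f) : e ∈ G.edgeSet ∧ f ∈ G.edgeSet := by
  obtain ⟨_, ⟨X, hX, rfl⟩, h1, h2⟩ := h
  exact ⟨h1.1, h2.1⟩

theorem edgeBicliqueHypergraph_adj_self [Finite V] {G : SimpleGraph V} {e : Sym2 V}
    (h : e ∈ G.edgeSet) : G.edgeBicliqueHypergraph.Adj e e := by
  induction e with
  | _ p q =>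
    have hpq : G.Adj p q := h
    rw [edgeBicliqueHypergraph_adj_mk_iff G hpq hpq]
    exact Or.inl ⟨hpq, hpq.symm, G.irrefl, G.irrefl⟩

/-- No edge lies in common bicliques with all three edges of a triangle. -/
theorem not_edgeBicliqueHypergraph_adj_triangle [Finite V] {G : SimpleGraph V} {x y z : V}
    (hxy : G.Adj x y) (hyz : G.Adj y z) (hxz : G.Adj x z) (u : Sym2 V)
    (h1 : G.edgeBicliqueHypergraph.Adj s(x, y) u) (h2 : G.edgeBicliqueHypergraph.Adj s(y, z) u)
    (h3 : G.edgeBicliqueHypergraph.Adj s(x, z) u) : False := by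
  induction u with
  | _ p q =>
    have hpq : G.Adj p q := (edgeBicliqueHypergraph_adj_mem h1).2
    rw [edgeBicliqueHypergraph_adj_mk_iff G ‹_› hpq] at h1 h2 h3
    unfold Aligned at h1 h2 h3
    -- By `h1`, `h2`, `h3` the vertex `p` is adjacent to exactly one of any two of `x`, `y`, `z`,
    -- which is impossible for three vertices.
    tauto

/-- Three edges that lie pairwise, but with incompatible sides, in common bicliques. -/
def TwistedTriple (G : SimpleGraph V) (a b x y z w : V) : Prop :=
  G.Adj a b ∧ G.Adj x y ∧ G.Adj z w ∧
    G.Aligned a b x y ∧ G.Aligned a b z w ∧ G.Aligned x y w z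

/-- The triangle is `b`, `x`, `z`: each of its edges lies in a biclique with two of the three given
edges. The hypothesis on `u` follows both from the Helly property and from `TriangleHelly`, so this
one argument serves both. -/
theorem TwistedTriple.false_of_adj [Finite V] {G : SimpleGraph V} {a b x y z w : V}
    (h : G.TwistedTriple a b x y z w) (u : Sym2 V)
    (hu : ∀ E ∈ G.edgeBicliqueHypergraph.edgesThroughTwo s(a, b) s(x, y) s(z, w), ∀ e ∈ E,
      G.edgeBicliqueHypergraph.Adj e u) : False := by
  obtain ⟨hab, hxy, hzw, h1, h2, h3⟩ := h
  obtain ⟨E₁, hE₁, i1, j1, k1⟩ := h1.exists_edge hab hxy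
  obtain ⟨E₂, hE₂, i2, j2, k2⟩ := h2.exists_edge hab hzw
  have h3' : G.Aligned y x z w := ⟨h3.2.1, h3.1, h3.2.2.2, h3.2.2.1⟩
  obtain ⟨E₃, hE₃, i3, j3, k3⟩ := h3'.exists_edge hxy.symm hzw
  rw [Sym2.eq_swap] at i3
  exact not_edgeBicliqueHypergraph_adj_triangle h1.2.1 h3.1 h2.2.1 u
    (hu E₁ ⟨hE₁, Or.inl ⟨i1, j1⟩⟩ _ k1) (hu E₃ ⟨hE₃, Or.inr (Or.inl ⟨i3, j3⟩)⟩ _ k3)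
    (hu E₂ ⟨hE₂, Or.inr (Or.inr ⟨i2, j2⟩)⟩ _ k2)

theorem TwistedTriple.adj {G : SimpleGraph V} [Finite V] {a b x y z w : V}
    (h : G.TwistedTriple a b x y z w) :
    G.edgeBicliqueHypergraph.Adj s(a, b) s(x, y) ∧
      G.edgeBicliqueHypergraph.Adj s(x, y) s(z, w) ∧
      G.edgeBicliqueHypergraph.Adj s(a, b) s(z, w) := by
  obtain ⟨hab, hxy, hzw, h1, h2, h3⟩ := h
  exact ⟨(edgeBicliqueHypergraph_adj_mk_iff G hab hxy).2 (Or.inl h1),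
    (edgeBicliqueHypergraph_adj_mk_iff G hxy hzw).2 (Or.inr h3),
    (edgeBicliqueHypergraph_adj_mk_iff G hab hzw).2 (Or.inl h2)⟩

theorem not_twistedTriple_of_isHelly [Finite V] {G : SimpleGraph V}
    (hG : G.edgeBicliqueHypergraph.IsHelly) (a b x y z w : V) :
    ¬ G.TwistedTriple a b x y z w := by
  intro h
  obtain ⟨u, hu⟩ := hG.edgesThroughTwo_nonempty (c := s(z, w)) h.adj.1
  exact h.false_of_adj u fun E hE e he => ⟨E, hE.1, he, hu E hE⟩

theorem not_twistedTriple_of_triangleHelly [Finite V] {G : SimpleGraph V}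
    (hG : TriangleHelly G.edgeBicliqueHypergraph.Adj) (a b x y z w : V) :
    ¬ G.TwistedTriple a b x y z w := by
  intro h
  obtain ⟨u, hu⟩ := hG _ _ _ h.adj.1 h.adj.2.1 h.adj.2.2
  refine h.false_of_adj u fun E hE e he => hu e ?_
  obtain ⟨hE, hE2⟩ := hE
  rcases hE2 with ⟨h1, h2⟩ | ⟨h1, h2⟩ | ⟨h1, h2⟩
  · exact Or.inl ⟨⟨E, hE, he, h1⟩, ⟨E, hE, he, h2⟩⟩
  · exact Or.inr (Or.inl ⟨⟨E, hE, he, h1⟩, ⟨E, hE, he, h2⟩⟩)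
  · exact Or.inr (Or.inr ⟨⟨E, hE, he, h1⟩, ⟨E, hE, he, h2⟩⟩)

/-- Without twisted triples, edges that pairwise lie in common bicliques lie in one biclique. -/
theorem exists_biclique_of_pairwise_adj [Finite V] {G : SimpleGraph V}
    (hG : ∀ a b x y z w, ¬ G.TwistedTriple a b x y z w) {F : Set (Sym2 V)} (hne : F.Nonempty)
    (hF : ∀ e ∈ F, ∀ f ∈ F, G.edgeBicliqueHypergraph.Adj e f) :
    ∃ X, G.IsBiclique X ∧ F ⊆ G.edgesInside X := by
  obtain ⟨e, he⟩ := hne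
  induction e with
  | _ a b =>
    have hab : G.Adj a b := (edgeBicliqueHypergraph_adj_mem (hF _ he _ he)).1
    have hends : ∀ f ∈ F, ∃ x y, f = s(x, y) ∧ G.Adj x y ∧ G.Aligned a b x y := by
      intro f hf
      have h := hF _ he f hf
      induction f with
      | _ x y =>
        have hxy : G.Adj x y := (edgeBicliqueHypergraph_adj_mem h).2
        rcases (edgeBicliqueHypergraph_adj_mk_iff G hab hxy).1 h with h | h
        · exact ⟨x, y, rfl, hxy, h⟩
        · exact ⟨y, x, Sym2.eq_swap, hxy.symm, h⟩
    -- All edges of `F` are oriented by the fixed edge `ab`; two of them whose orientations disagree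
    -- would form a twisted triple with `ab`.
    have hpair : ∀ x y z w, s(x, y) ∈ F → s(z, w) ∈ F → G.Adj x y → G.Adj z w →
        G.Aligned a b x y → G.Aligned a b z w → G.Aligned x y z w := by
      intro x y z w hxyF hzwF hxy hzw h1 h2
      rcases (edgeBicliqueHypergraph_adj_mk_iff G hxy hzw).1 (hF _ hxyF _ hzwF) with h | h
      · exact h
      · exact absurd ⟨hab, hxy, hzw, h1, h2, h⟩ (hG a b x y z w)
    let S : Set V := {x | ∃ y, s(x, y) ∈ F ∧ G.Adj x y ∧ G.Aligned a b x y}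
    let T : Set V := {y | ∃ x, s(x, y) ∈ F ∧ G.Adj x y ∧ G.Aligned a b x y}
    have haa : G.Aligned a b a b := ⟨hab, hab.symm, G.irrefl, G.irrefl⟩
    obtain ⟨X, hX, hsub⟩ := (inducesCompleteBipartite_union (G := G) (S := S) (T := T)
      ⟨a, b, he, hab, haa⟩ ⟨b, a, he, hab, haa⟩
      (by
        rintro x ⟨y, h1, h2, h3⟩ z ⟨w, k1, k2, k3⟩
        exact (hpair x y z w h1 k1 h2 k2 h3 k3).2.2.1)
      (by
        rintro y ⟨x, h1, h2, h3⟩ w ⟨z, k1, k2, k3⟩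
        exact (hpair x y z w h1 k1 h2 k2 h3 k3).2.2.2)
      (by
        rintro x ⟨y, h1, h2, h3⟩ w ⟨z, k1, k2, k3⟩
        exact (hpair x y z w h1 k1 h2 k2 h3 k3).1)).exists_biclique
    refine ⟨X, hX, fun f hf => ?_⟩
    obtain ⟨x, y, rfl, hxy, h⟩ := hends f hf
    refine ⟨hxy, fun v hv => hsub ?_⟩
    rcases Sym2.mem_iff.1 hv with rfl | rfl
    · exact Or.inl ⟨y, hf, hxy, h⟩
    · exact Or.inr ⟨x, hf, hxy, h⟩

theorem IsBiclique.exists_mem_edgesInside {G : SimpleGraph V} {X : Set V} (hX : G.IsBiclique X)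
    {v : V} (hv : v ∈ X) : ∃ e ∈ G.edgesInside X, v ∈ e := by
  obtain ⟨S, T, ⟨s, hs⟩, ⟨t, ht⟩, -, hST, h⟩ := hX.prop
  have hsX : s ∈ X := hST ▸ Or.inl hs
  have htX : t ∈ X := hST ▸ Or.inr ht
  have hv' : v ∈ S ∪ T := hST.symm ▸ hv
  have : ∃ w ∈ X, G.Adj v w := by
    rcases hv' with hv' | hv'
    · exact ⟨t, htX, (h v hv t htX).2 (Or.inl ⟨hv', ht⟩)⟩
    · exact ⟨s, hsX, (h v hv s hsX).2 (Or.inr ⟨hv', hs⟩)⟩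
  obtain ⟨w, hw, hvw⟩ := this
  refine ⟨s(v, w), ⟨hvw, fun x hx => ?_⟩, Sym2.mem_mk_left v w⟩
  rcases Sym2.mem_iff.1 hx with rfl | rfl
  · exact hv
  · exact hw

/-- The edge-biclique hypergraph is Helly exactly if the relation of lying in a common biclique
satisfies the triangle criterion. -/
theorem edgeBicliqueHypergraph_isHelly_iff [Finite V] (G : SimpleGraph V) :
    G.edgeBicliqueHypergraph.IsHelly ↔ TriangleHelly G.edgeBicliqueHypergraph.Adj := by
  constructor
  · intro h
    refine h.triangleHelly fun e f g hef hfg heg => ?_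
    have he := edgeBicliqueHypergraph_adj_self (edgeBicliqueHypergraph_adj_mem hef).1
    have hf := edgeBicliqueHypergraph_adj_self (edgeBicliqueHypergraph_adj_mem hfg).1
    have hg := edgeBicliqueHypergraph_adj_self (edgeBicliqueHypergraph_adj_mem hfg).2
    obtain ⟨X, hX, hsub⟩ := exists_biclique_of_pairwise_adj (F := {e, f, g})
      (not_twistedTriple_of_isHelly h) (by simp) (by
        simp [hef, hfg, heg, hef.symm, hfg.symm, heg.symm, he, hf, hg])
    exact ⟨_, ⟨X, hX, rfl⟩, hsub (by simp), hsub (by simp), hsub (by simp)⟩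
  · intro h
    refine Hypergraph.isHelly_of_triangleHelly h ?_
    rintro _ ⟨X, hX, rfl⟩ u hu
    obtain ⟨v, hv⟩ : X.Nonempty := by
      obtain ⟨S, T, ⟨s, hs⟩, -, -, hST, -⟩ := hX.prop
      exact ⟨s, hST ▸ Or.inl hs⟩
    obtain ⟨e, he, -⟩ := hX.exists_mem_edgesInside hv
    have huu := edgeBicliqueHypergraph_adj_self (edgeBicliqueHypergraph_adj_mem (hu e he)).2
    -- The edges of `X` together with `u` lie in one biclique `Y`. Every vertex of `X` is on an edge
    -- of `X`, so `Y` contains `X` and equals it by maximality.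
    obtain ⟨Y, hY, hsub⟩ := exists_biclique_of_pairwise_adj (F := insert u (G.edgesInside X))
      (not_twistedTriple_of_triangleHelly h) ⟨u, by simp⟩ (by
        rintro f (rfl | hf) g (rfl | hg)
        · exact huu
        · exact (hu g hg).symm
        · exact hu f hf
        · exact ⟨_, ⟨X, hX, rfl⟩, hf, hg⟩)
    have hXY : X ⊆ Y := by
      intro v hv
      obtain ⟨f, hf, hvf⟩ := hX.exists_mem_edgesInside hv
      exact (hsub (Or.inr hf)).2 v hvf
    have hYX : Y ⊆ X := hX.le_of_ge hY.prop hXY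
    have hu' := hsub (Or.inl rfl)
    exact ⟨hu'.1, fun v hv => hYX (hu'.2 v hv)⟩

end SimpleGraph

/-! ### Transfer to the listed edges -/

namespace RAM

theorem EdgeList.ncard_edgeSet {n m : ℕ} {G : SimpleGraph (Fin n)} (L : EdgeList G m) :
    G.edgeSet.ncard = m := by
  rw [← Nat.card_coe_set_eq, ← Nat.card_eq_of_bijective _ L.bijective, Nat.card_fin]

theorem EdgeList.eq_or_bicliqueLineGraph_adj_iff {n m : ℕ} {G : SimpleGraph (Fin n)}
    (L : EdgeList G m) (i j : Fin m) :
    i = j ∨ (G.bicliqueLineGraph.comap L.edge).Adj i j ↔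
      G.edgeBicliqueHypergraph.Adj (L.edge i) (L.edge j) := by
  constructor
  · rintro (rfl | h)
    · exact SimpleGraph.edgeBicliqueHypergraph_adj_self (L.edge i).2
    · exact h.2
  · intro h
    by_cases hij : i = j
    · exact Or.inl hij
    · exact Or.inr ⟨fun he => hij (L.bijective.1 he), h⟩

/-- The edge-biclique hypergraph is Helly exactly if the biclique line graph is clique-Helly. -/
theorem EdgeList.isHelly_cliqueHypergraph_iff {n m : ℕ} {G : SimpleGraph (Fin n)}
    (L : EdgeList G m) :
    (G.bicliqueLineGraph.comap L.edge).cliqueHypergraph.IsHelly ↔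
      G.edgeBicliqueHypergraph.IsHelly := by
  rw [SimpleGraph.cliqueHypergraph_isHelly_iff, SimpleGraph.edgeBicliqueHypergraph_isHelly_iff,
    ← triangleHelly_onFun_iff (fun i => (L.edge i : Sym2 (Fin n)))
      (fun a b h => h.symm)
      (fun a b h => SimpleGraph.edgeBicliqueHypergraph_adj_self
        (SimpleGraph.edgeBicliqueHypergraph_adj_mem h).1)
      (fun a h => ?_)]
  · simp_rw [L.eq_or_bicliqueLineGraph_adj_iff]
  · obtain ⟨i, hi⟩ := L.bijective.2 ⟨a, (SimpleGraph.edgeBicliqueHypergraph_adj_mem h).1⟩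
    exact ⟨i, congrArg Subtype.val hi⟩

end RAM

/-! ### Time-bounded program rules: blocks, loops, searches -/

namespace RAM

/-- The word size granted to the test depends on its own input only; inside the composed program it
runs with larger words. -/
theorem Exec.mono {B B' : ℕ} (hB : B ≤ B') {p : Prog} {s s' : State} {t : ℕ}
    (h : Exec B p s t s') : Exec B' p s t s' := by
  induction h with
  | const h => exact .const (h.trans_le hB)
  | add h => exact .add (h.trans_le hB)
  | sub h => exact .sub (h.trans_le hB)
  | mul h => exact .mul (h.trans_le hB)
  | load h => exact .load (h.trans_le hB)
  | store h₁ h₂ => exact .store (h₁.trans_le hB) (h₂.trans_le hB)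
  | skip => exact .skip
  | seq _ _ h₁ h₂ => exact .seq h₁ h₂
  | if_pos h _ h₁ => exact .if_pos h h₁
  | if_neg h _ h₁ => exact .if_neg h h₁
  | while_done h => exact .while_done h
  | while_step h _ _ h₁ h₂ => exact .while_step h h₁ h₂

namespace State

@[simp] theorem reg_setReg (s : State) (x v y : ℕ) :
    (s.setReg x v).reg y = if y = x then v else s.reg y := by
  simp [setReg, Function.update_apply]

@[simp] theorem arr_setReg (s : State) (x v : ℕ) : (s.setReg x v).arr = s.arr := rfl

@[simp] theorem reg_setCell (s : State) (a i v : ℕ) : (s.setCell a i v).reg = s.reg := rfl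

@[simp] theorem arr_setCell (s : State) (a i v b j : ℕ) :
    (s.setCell a i v).arr b j = if b = a ∧ j = i then v else s.arr b j := by
  by_cases hb : b = a
  · subst hb
    simp [setCell, Function.update_apply]
  · simp [setCell, hb]

theorem setReg_setReg (s : State) (x v w : ℕ) : (s.setReg x v).setReg x w = s.setReg x w := by
  simp [setReg]

/-- The registers below `K`, except possibly `f`, are the same. -/
def Agree (K f : ℕ) (s s' : State) : Prop := ∀ r < K, r ≠ f → s'.reg r = s.reg r

theorem Agree.trans {K K' f f' : ℕ} {s s' s'' : State} (h : Agree K f s s')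
    (h' : Agree K' f' s' s'') (hK : K ≤ K' := by omega) (hf : f' = f ∨ K ≤ f' := by omega) :
    Agree K f s s'' := by
  intro r hr hrf
  rw [h' r (by omega) (by omega), h r hr hrf]

end State

open State

/-- The program `p` stops after at most `T` steps in a state with the property `Q`. -/
def Runs (B : ℕ) (p : Prog) (s : State) (T : ℕ) (Q : State → Prop) : Prop :=
  ∃ t s', Exec B p s t s' ∧ t ≤ T ∧ Q s'

/-- A list of programs, run one after another. -/
def block : List Prog → Prog
  | [] => .skip
  | p :: l => .seq p (block l)

namespace Runs

variable {B T T₁ T₂ : ℕ} {s : State} {Q R : State → Prop} {p q : Prog} {l : List Prog}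

theorem mono (h : Runs B p s T₁ R) (hT : T₁ ≤ T) (hQ : ∀ s', R s' → Q s') :
    Runs B p s T Q := by
  obtain ⟨t, s', h1, h2, h3⟩ := h
  exact ⟨t, s', h1, h2.trans hT, hQ _ h3⟩

theorem seq (h : Runs B p s T₁ (fun s' => Runs B q s' T₂ Q)) :
    Runs B (.seq p q) s (T₁ + T₂) Q := by
  obtain ⟨t, s', h1, h2, t', s'', h3, h4, h5⟩ := h
  exact ⟨t + t', s'', .seq h1 h3, by omega, h5⟩

/-- The empty block is a `skip`, so a block costs one step more than its entries together. -/
theorem nil (h : Q s) : Runs B (block []) s (T + 1) Q := ⟨1, s, .skip, by omega, h⟩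

theorem cons (h : Runs B p s T₁ (fun s' => Runs B (block l) s' T Q)) :
    Runs B (block (p :: l)) s (T + T₁) Q := by
  rw [Nat.add_comm]
  exact h.seq

theorem const {x c : ℕ} (hc : c < B) (h : Q (s.setReg x c)) : Runs B (.const x c) s (T + 1) Q :=
  ⟨1, _, .const hc, by omega, h⟩

theorem add {x y z : ℕ} (hc : s.reg y + s.reg z < B)
    (h : Q (s.setReg x (s.reg y + s.reg z))) : Runs B (.add x y z) s (T + 1) Q :=
  ⟨1, _, .add hc, by omega, h⟩

theorem sub {x y z : ℕ} (hc : s.reg y - s.reg z < B)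
    (h : Q (s.setReg x (s.reg y - s.reg z))) : Runs B (.sub x y z) s (T + 1) Q :=
  ⟨1, _, .sub hc, by omega, h⟩

theorem mul {x y z : ℕ} (hc : s.reg y * s.reg z < B)
    (h : Q (s.setReg x (s.reg y * s.reg z))) : Runs B (.mul x y z) s (T + 1) Q :=
  ⟨1, _, .mul hc, by omega, h⟩

theorem load {x a y : ℕ} (hc : s.arr a (s.reg y) < B)
    (h : Q (s.setReg x (s.arr a (s.reg y)))) : Runs B (.load x a y) s (T + 1) Q :=
  ⟨1, _, .load hc, by omega, h⟩

theorem store {a x y : ℕ} (hx : s.reg x < B) (hy : s.reg y < B)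
    (h : Q (s.setCell a (s.reg x) (s.reg y))) : Runs B (.store a x y) s (T + 1) Q :=
  ⟨1, _, .store hx hy, by omega, h⟩

theorem skip (h : Q s) : Runs B .skip s (T + 1) Q := ⟨1, s, .skip, by omega, h⟩

theorem ifLt {x y : ℕ} (h₁ : s.reg x < s.reg y → Runs B p s T Q)
    (h₂ : ¬ s.reg x < s.reg y → Runs B q s T Q) : Runs B (.ifLt x y p q) s (T + 1) Q := by
  by_cases h : s.reg x < s.reg y
  · obtain ⟨t, s', h3, h4, h5⟩ := h₁ h
    exact ⟨t + 1, s', .if_pos h h3, by omega, h5⟩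
  · obtain ⟨t, s', h3, h4, h5⟩ := h₂ h
    exact ⟨t + 1, s', .if_neg h h3, by omega, h5⟩

end Runs

/-- `reg x := arr a (reg i * reg n + reg j)` -/
def loadMatrix (x a i j n : ℕ) : Prog :=
  .seq (.mul x i n) (.seq (.add x x j) (.load x a x))

/-- `reg x := arr a ((reg i * reg n + reg j) * reg n + reg k)` -/
def loadTable (x a i j k n : ℕ) : Prog :=
  .seq (.mul x i n) (.seq (.add x x j) (.seq (.mul x x n) (.seq (.add x x k) (.load x a x))))

theorem Runs.loadMatrix {B x a i j n I J N v T : ℕ} {s : State} {Q : State → Prop}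
    (hi : s.reg i = I) (hj : s.reg j = J) (hn : s.reg n = N) (hv : s.arr a (I * N + J) = v)
    (hjx : j ≠ x) (hB : I * N + J < B) (hvB : v < B) (h : Q (s.setReg x v)) :
    Runs B (loadMatrix x a i j n) s (T + 3) Q := by
  subst hi hj hn hv
  refine Runs.mono (T₁ := 0 + 1 + (0 + 1 + (0 + 1))) (R := Q) ?_ (by omega) (fun _ h => h)
  refine Runs.seq (Runs.mul (by omega) (Runs.seq (Runs.add ?_ (Runs.load ?_ ?_)))) <;>
    simpa [hjx, setReg_setReg]

theorem Runs.loadTable {B x a i j k n I J K N v T : ℕ} {s : State} {Q : State → Prop}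
    (hi : s.reg i = I) (hj : s.reg j = J) (hk : s.reg k = K) (hn : s.reg n = N)
    (hv : s.arr a ((I * N + J) * N + K) = v)
    (hjx : j ≠ x) (hkx : k ≠ x) (hnx : n ≠ x) (hB₀ : I * N + J < B)
    (hB : (I * N + J) * N + K < B) (hvB : v < B)
    (h : Q (s.setReg x v)) :
    Runs B (loadTable x a i j k n) s (T + 5) Q := by
  subst hi hj hk hn hv
  refine Runs.mono (T₁ := 0 + 1 + (0 + 1 + (0 + 1 + (0 + 1 + (0 + 1))))) (R := Q) ?_
    (by omega) (fun _ h => h)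
  refine Runs.seq (Runs.mul (by omega) (Runs.seq (Runs.add ?_ (Runs.seq (Runs.mul ?_
    (Runs.seq (Runs.add ?_ (Runs.load ?_ ?_)))))))) <;>
    simp [hjx, hkx, hnx, setReg_setReg] <;> first | assumption | omega

/-- For `reg i` from `0` to `reg n - 1` run `body`; register `i + 1` is overwritten. -/
def forLoop (i n : ℕ) (body : Prog) : Prog :=
  .seq (.const i 0) (.whileLt i n (.seq body (.seq (.const (i + 1) 1) (.add i i (i + 1)))))

/-- The invariant sees the number of finished rounds, the arrays and one register `f`. Registers
above the counter `K` are free for the body, so nested loops use increasing counters. Each round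
adds three steps (test, constant, increment); the initialization and the last test add two. -/
theorem Runs.forLoop {B T K n f N : ℕ} {s : State} {body : Prog}
    (P : ℕ → (ℕ → ℕ → ℕ) → ℕ → Prop) (hn : s.reg n = N) (hnK : n < K) (hnf : n ≠ f) (hf : f < K)
    (hB : 1 < B) (hNB : N < B) (h0 : P 0 s.arr (s.reg f))
    (hbody : ∀ j < N, ∀ s', Agree K f s s' → s'.reg K = j → P j s'.arr (s'.reg f) →
      Runs B body s' T (fun s'' => Agree (K + 1) f s' s'' ∧ P (j + 1) s''.arr (s''.reg f))) :
    Runs B (forLoop K n body) s (N * (T + 3) + 2)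
      (fun s' => Agree K f s s' ∧ P N s'.arr (s'.reg f)) := by
  -- Induction on the number `d` of remaining rounds.
  have key : ∀ d j s', j + d = N → Agree K f s s' → s'.reg K = j → P j s'.arr (s'.reg f) →
      Runs B (.whileLt K n (.seq body (.seq (.const (K + 1) 1) (.add K K (K + 1))))) s'
        (d * (T + 3) + 1) (fun s' => Agree K f s s' ∧ P N s'.arr (s'.reg f)) := by
    intro d
    induction d with
    | zero =>
      intro j s' hj hA hK hP
      obtain rfl : j = N := by omega
      have hn' : s'.reg n = j := by rw [hA n hnK hnf, hn]
      exact ⟨1, s', .while_done (by omega), by omega, hA, hP⟩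
    | succ d ih =>
      intro j s' hj hA hK hP
      have hn' : s'.reg n = N := by rw [hA n hnK hnf, hn]
      obtain ⟨t, s₁, hE, ht, hA₁, hP₁⟩ := hbody j (by omega) s' hA hK hP
      have hK₁ : s₁.reg K = j := by rw [hA₁ K (by omega) (by omega), hK]
      obtain ⟨t₂, s₂, hE₂, ht₂, hQ⟩ := ih (j + 1) ((s₁.setReg (K + 1) 1).setReg K (j + 1))
        (by omega)
        (by
          intro r hr hrf
          have h1 := hA₁ r (by omega) hrf
          have h2 := hA r hr hrf
          have h3 : r ≠ K := by omega
          have h4 : r ≠ K + 1 := by omega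
          simp [h3, h4, h1, h2])
        (by simp)
        (by
          have h3 : f ≠ K := by omega
          have h4 : f ≠ K + 1 := by omega
          simpa [h3, h4] using hP₁)
      have hadd : Exec B (.add K K (K + 1)) (s₁.setReg (K + 1) 1) 1
          ((s₁.setReg (K + 1) 1).setReg K (j + 1)) := by
        have := Exec.add (B := B) (s := s₁.setReg (K + 1) 1) (x := K) (y := K) (z := K + 1)
          (by simp; omega)
        simpa [hK₁] using this
      refine ⟨_, s₂, .while_step (by omega) (.seq hE (.seq (.const hB) hadd)) hE₂, ?_, hQ⟩
      have : (d + 1) * (T + 3) = d * (T + 3) + (T + 3) := by ring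
      omega
  have h1 : f ≠ K := by omega
  refine Runs.mono (T₁ := 0 + 1 + (N * (T + 3) + 1)) (Runs.seq (Runs.const (by omega)
    (key N 0 _ (by omega) ?_ (by simp) (by simpa [h1] using h0)))) (by omega) (fun _ h => h)
  intro r hr _
  have : r ≠ K := by omega
  simp [this]

theorem mul_add_lt_mul {i j M N : ℕ} (hi : i < M) (hj : j < N) : i * N + j < M * N := by
  nlinarith

theorem mul_add_inj {i j i' j' N : ℕ} (hj : j < N) (hj' : j' < N)
    (h : i * N + j = i' * N + j') : i = i' ∧ j = j' := by
  have hN : 0 < N := by omega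
  have h1 : (i * N + j) / N = i := by
    rw [Nat.add_comm, Nat.add_mul_div_right _ _ hN, Nat.div_eq_of_lt hj, Nat.zero_add]
  have h2 : (i' * N + j') / N = i' := by
    rw [Nat.add_comm, Nat.add_mul_div_right _ _ hN, Nat.div_eq_of_lt hj', Nat.zero_add]
  have : i = i' := by rw [← h1, ← h2, h]
  subst this
  exact ⟨rfl, by omega⟩

/-- Two nested loops, run by the registers `2` and `3`. -/
def loop₂ (n : ℕ) (body : Prog) : Prog := forLoop 2 n (forLoop 3 n body)

/-- The finished rounds are counted in row-major order, so the count equals the address of the next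
matrix cell. -/
theorem Runs.loop₂ {B T n f N : ℕ} {s : State} {body : Prog}
    (P : ℕ → (ℕ → ℕ → ℕ) → ℕ → Prop) (hn : s.reg n = N) (hn2 : n < 2) (hnf : n ≠ f) (hf : f < 2)
    (hB : 1 < B) (hNB : N < B) (h0 : P 0 s.arr (s.reg f))
    (hbody : ∀ a < N, ∀ b < N, ∀ s', Agree 2 f s s' → s'.reg 2 = a → s'.reg 3 = b →
      P (a * N + b) s'.arr (s'.reg f) →
      Runs B body s' T
        (fun s'' => Agree 4 f s' s'' ∧ P (a * N + b + 1) s''.arr (s''.reg f))) :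
    Runs B (loop₂ n body) s (N * (N * (T + 3) + 2 + 3) + 2)
      (fun s' => Agree 2 f s s' ∧ P (N * N) s'.arr (s'.reg f)) := by
  refine Runs.forLoop (fun a => P (a * N)) hn hn2 hnf hf hB hNB (by simpa using h0) ?_
  intro a ha s₁ hs₁ h2 hP
  have hn₁ : s₁.reg n = N := by rw [hs₁ n hn2 hnf, hn]
  refine (Runs.forLoop (fun b => P (a * N + b)) hn₁ (by omega) hnf (by omega) hB hNB
    (by simpa using hP) ?_).mono le_rfl ?_
  · intro b hb s₂ hs₂ h3 hP
    exact hbody a ha b hb s₂ (hs₁.trans hs₂) (by rw [hs₂ 2 (by omega) (by omega), h2]) h3 hP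
  · rintro s₂ ⟨h1, h2⟩
    exact ⟨h1, by simpa [Nat.add_mul] using h2⟩

/-- Three nested loops, run by the registers `2`, `3` and `4`. -/
def loop₃ (n : ℕ) (body : Prog) : Prog := loop₂ n (forLoop 4 n body)

theorem Runs.loop₃ {B T n f N : ℕ} {s : State} {body : Prog}
    (P : ℕ → (ℕ → ℕ → ℕ) → ℕ → Prop) (hn : s.reg n = N) (hn2 : n < 2) (hnf : n ≠ f) (hf : f < 2)
    (hB : 1 < B) (hNB : N < B) (h0 : P 0 s.arr (s.reg f))
    (hbody : ∀ a < N, ∀ b < N, ∀ c < N, ∀ s', Agree 2 f s s' → s'.reg 2 = a → s'.reg 3 = b →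
      s'.reg 4 = c → P ((a * N + b) * N + c) s'.arr (s'.reg f) →
      Runs B body s' T
        (fun s'' => Agree 5 f s' s'' ∧ P ((a * N + b) * N + c + 1) s''.arr (s''.reg f))) :
    Runs B (loop₃ n body) s (N * (N * (N * (T + 3) + 2 + 3) + 2 + 3) + 2)
      (fun s' => Agree 2 f s s' ∧ P (N * N * N) s'.arr (s'.reg f)) := by
  refine Runs.loop₂ (fun k => P (k * N)) hn hn2 hnf hf hB hNB (by simpa using h0) ?_
  intro a ha b hb s₁ hs₁ h2 h3 hP
  have hn₁ : s₁.reg n = N := by rw [hs₁ n hn2 hnf, hn]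
  refine (Runs.forLoop (fun c => P ((a * N + b) * N + c)) hn₁ (by omega) hnf (by omega) hB hNB
    (by simpa using hP) ?_).mono le_rfl ?_
  · intro c hc s₂ hs₂ h4 hP
    exact hbody a ha b hb c hc s₂ (hs₁.trans hs₂) (by rw [hs₂ 2 (by omega) (by omega), h2])
      (by rw [hs₂ 3 (by omega) (by omega), h3]) h4 hP
  · rintro s₂ ⟨h1, h2⟩
    exact ⟨h1, by simpa [Nat.add_mul] using h2⟩

/-- Register `5` tells whether `body` makes register `7` smaller than register `8` for some value
of register `6` below that of register `0`. -/
def search (body : Prog) : Prog :=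
  .seq (.const 5 0) (forLoop 6 0 (.seq body (.ifLt 7 8 (.const 5 1) .skip)))

open Classical in
theorem Runs.search {B T N : ℕ} {s : State} {body : Prog} (C : ℕ → Prop) (hn : s.reg 0 = N)
    (hB : 1 < B) (hNB : N < B)
    (hbody : ∀ w < N, ∀ s', Agree 5 5 s s' → s'.arr = s.arr → s'.reg 6 = w →
      Runs B body s' T
        (fun s'' => Agree 7 7 s' s'' ∧ s''.arr = s'.arr ∧ (s''.reg 7 < s''.reg 8 ↔ C w))) :
    Runs B (search body) s (N * (T + 2 + 3) + 2 + 1)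
      (fun s' => Agree 5 5 s s' ∧ s'.arr = s.arr ∧
        s'.reg 5 = if ∃ w < N, C w then 1 else 0) := by
  refine Runs.mono (T₁ := 0 + 1 + (N * (T + 2 + 3) + 2)) (Runs.seq (Runs.const (by omega) ?_))
    (by omega) (fun _ h => h)
  refine (Runs.forLoop (f := 5) (fun j arr f => arr = s.arr ∧ f = if ∃ w < j, C w then 1 else 0)
    (N := N) (by simpa using hn) (by omega) (by omega) (by omega) hB hNB (by simp) ?_).mono
    le_rfl ?_
  · rintro w hw s₁ hs₁ h6 ⟨harr, hf⟩
    have hs₁' : Agree 5 5 s s₁ := by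
      intro r hr hr5
      rw [hs₁ r (by omega) (by omega)]
      simp [hr5]
    refine Runs.seq ((hbody w hw s₁ hs₁' harr h6).mono le_rfl ?_)
    rintro s₂ ⟨h1, h2, h3⟩
    have h5 := h1 5 (by omega) (by omega)
    refine Runs.ifLt (fun hlt => Runs.const hB ⟨?_, ?_, ?_⟩) (fun hlt => Runs.skip ⟨?_, ?_, ?_⟩)
    · intro r hr hr5
      simp [hr5, h1 r hr (by omega)]
    · rw [arr_setReg, h2, harr]
    · rw [if_pos ⟨w, by omega, h3.1 hlt⟩]
      simp
    · intro r hr hr5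
      exact h1 r hr (by omega)
    · rw [h2, harr]
    -- The test failed, so `w` is not a solution and the flag stays correct for the longer range.
    · rw [h5, hf]
      refine if_congr ⟨?_, ?_⟩ rfl rfl
      · rintro ⟨v, hv, hC⟩
        exact ⟨v, by omega, hC⟩
      · rintro ⟨v, hv, hC⟩
        refine ⟨v, ?_, hC⟩
        have : v ≠ w := by
          rintro rfl
          exact hlt (h3.2 hC)
        omega
  · rintro s₁ ⟨h1, h2, h3⟩
    refine ⟨?_, h2, h3⟩
    intro r hr hr5
    rw [h1 r (by omega) (by omega)]
    simp [hr5]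

end RAM

/-! ### The clique-Helly test -/

namespace RAM

open State

open Classical in
/-- The list `A` starts with the `N × N` matrix of the relation `r`, row by row. -/
def HoldsMatrix (A : ℕ → ℕ) (N : ℕ) (r : ℕ → ℕ → Prop) : Prop :=
  ∀ i < N, ∀ j < N, A (i * N + j) = if r i j then 1 else 0

theorem HoldsMatrix.congr {A : ℕ → ℕ} {N : ℕ} {r r' : ℕ → ℕ → Prop} (h : HoldsMatrix A N r)
    (hr : ∀ i < N, ∀ j < N, r i j ↔ r' i j) : HoldsMatrix A N r' := by
  intro i hi j hj
  rw [h i hi j hj, propext (hr i hi j hj)]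

/-- Set the diagonal of the matrix in array `2` to one. -/
def closeDiagonal : Prog :=
  forLoop 2 0 (block [.mul 3 2 0, .add 3 3 2, .const 4 1, .store 2 3 4])

/-- The triangle criterion concerns the reflexive relation, whereas an adjacency matrix has zero
diagonal. -/
theorem Runs.closeDiagonal {B N : ℕ} {s : State} {r : ℕ → ℕ → Prop} (hB : 1 < B) (hNB : N < B)
    (hN2 : N * N < B) (hn : s.reg 0 = N) (h : HoldsMatrix (s.arr 2) N r) :
    Runs B closeDiagonal s (N * 8 + 2)
      (fun s' => s'.reg 0 = N ∧ HoldsMatrix (s'.arr 2) N (fun i j => i = j ∨ r i j)) := by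
  classical
  refine (Runs.forLoop (f := 1) (T := 5)
    (fun k A _ => HoldsMatrix (A 2) N (fun i j => i = j ∧ i < k ∨ r i j))
    hn (by omega) (by omega) (by omega) hB hNB (by simpa using h) ?_).mono le_rfl ?_
  · intro k hk s₁ hs₁ h2 hP
    have h0 : s₁.reg 0 = N := by rw [hs₁ 0 (by omega) (by omega), hn]
    have hlt := mul_add_lt_mul hk hk
    refine Runs.cons (Runs.mul (T := 0) (by simp [h0, h2]; omega) ?_)
    refine Runs.cons (Runs.add (T := 0) (by simp [h0, h2]; omega) ?_)
    refine Runs.cons (Runs.const (T := 0) hB ?_)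
    refine Runs.cons (Runs.store (T := 0) (by simp [h0, h2]; omega) (by simpa using hB) ?_)
    refine Runs.nil (T := 0) ⟨?_, ?_⟩
    · intro r hr _
      simp [show r ≠ 3 by omega, show r ≠ 4 by omega]
    · intro i hi j hj
      simp only [arr_setCell, reg_setReg, arr_setReg, h0, h2]
      simp only [reduceIte, true_and, Nat.reduceEqDiff]
      split_ifs with h3 h4 h4
      · rfl
      · obtain ⟨rfl, rfl⟩ := mul_add_inj hj hk h3
        exact absurd (Or.inl ⟨rfl, by omega⟩) h4
      · rw [hP i hi j hj]
        refine if_pos (h4.imp_left ?_)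
        rintro ⟨rfl, h5⟩
        refine ⟨rfl, ?_⟩
        have : i ≠ k := by
          rintro rfl
          exact h3 rfl
        omega
      · rw [hP i hi j hj]
        refine if_neg fun h5 => h4 (h5.imp_left ?_)
        rintro ⟨rfl, h6⟩
        exact ⟨rfl, by omega⟩
  · rintro s₁ ⟨h1, h2⟩
    refine ⟨by rw [h1 0 (by omega) (by omega), hn], ?_⟩
    exact h2.congr fun i hi j _ => or_congr_left (and_iff_left hi)

/-- Element `w` is related to `a` and `b`, but not to `u`. -/
def Excludes (r : ℕ → ℕ → Prop) (a b u w : ℕ) : Prop := r a w ∧ r b w ∧ ¬ r u w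

/-- Some element below `N` is related to `a` and `b`, but not to `u`. -/
def Excluded (N : ℕ) (r : ℕ → ℕ → Prop) (a b u : ℕ) : Prop := ∃ w < N, Excludes r a b u w

open Classical in
/-- The list `A` starts with the table telling whether some element below `N` is related to
`a` and `b`, but not to `u`. -/
def HoldsTable (A : ℕ → ℕ) (N : ℕ) (r : ℕ → ℕ → Prop) : Prop :=
  ∀ a < N, ∀ b < N, ∀ u < N,
    A ((a * N + b) * N + u) = if Excluded N r a b u then 1 else 0

/-- Make register `7` smaller than register `8` if element `reg 6` is related to `reg 2` and
`reg 3`, but not to `reg 4`. -/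
def excludeBody : Prog :=
  block [loadMatrix 7 2 2 6 0, loadMatrix 8 2 3 6 0, .mul 8 7 8, loadMatrix 7 2 4 6 0]

/-- Write the table of all exclusions to array `3`. -/
def excludeTable : Prog :=
  loop₃ 0 (block [search excludeBody,
    .mul 6 2 0, .add 6 6 3, .mul 6 6 0, .add 6 6 4, .store 3 6 5])

/-- Register `8` ends with the product of the entries at `(a, w)` and `(b, w)`, register `7` with
the entry at `(u, w)`. For zeros and ones, the comparison is the required conjunction. -/
theorem Runs.search_exclude {B N a b u : ℕ} {s : State} {r : ℕ → ℕ → Prop} (hB : 1 < B)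
    (hN2 : N * N < B) (hn : s.reg 0 = N) (h : HoldsMatrix (s.arr 2) N r)
    (ha : s.reg 2 = a) (hb : s.reg 3 = b) (hu : s.reg 4 = u) (haN : a < N) (hbN : b < N)
    (huN : u < N) {w : ℕ} (hw : s.reg 6 = w) (hwN : w < N) :
    Runs B excludeBody s 11
      (fun s' => Agree 7 7 s s' ∧ s'.arr = s.arr ∧
        (s'.reg 7 < s'.reg 8 ↔ Excludes r a b u w)) := by
  classical
  have h01 : ∀ (p : Prop) [Decidable p], (if p then 1 else 0) < B :=
    fun p _ => by split_ifs <;> omega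
  have h1 := mul_add_lt_mul haN hwN
  have h2 := mul_add_lt_mul hbN hwN
  have h3 := mul_add_lt_mul huN hwN
  refine Runs.cons (Runs.loadMatrix (T := 0) ha hw hn (by exact h a haN w hwN) (by omega)
    (by omega) (h01 _) ?_)
  refine Runs.cons (Runs.loadMatrix (T := 0) (I := b) (J := w) (N := N) (by simp [hb]) (by simp [hw])
    (by simp [hn]) (by exact h b hbN w hwN) (by omega) (by omega) (h01 _) ?_)
  refine Runs.cons (Runs.mul (T := 0) ?_ ?_)
  · simp
    split_ifs <;> omega
  refine Runs.cons (Runs.loadMatrix (T := 0) (I := u) (J := w) (N := N) (by simp [hu]) (by simp [hw])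
    (by simp [hn]) (by exact h u huN w hwN) (by omega) (by omega) (h01 _) ?_)
  refine Runs.nil (T := 0) ⟨?_, rfl, ?_⟩
  · intro r hr _
    simp [show r ≠ 7 by omega, show r ≠ 8 by omega]
  · unfold Excludes
    by_cases h1 : r a w <;> by_cases h2 : r b w <;> by_cases h3 : r u w <;> simp [h1, h2, h3]

theorem mul_add_lt_mul₃ {a b c N : ℕ} (ha : a < N) (hb : b < N) (hc : c < N) :
    (a * N + b) * N + c < N * N * N :=
  mul_add_lt_mul (mul_add_lt_mul ha hb) hc

theorem mul_add_inj₃ {a b c a' b' c' N : ℕ} (hb : b < N) (hc : c < N) (hb' : b' < N)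
    (hc' : c' < N) (h : (a * N + b) * N + c = (a' * N + b') * N + c') :
    a = a' ∧ b = b' ∧ c = c' := by
  obtain ⟨h1, h2⟩ := mul_add_inj hc hc' h
  obtain ⟨h3, h4⟩ := mul_add_inj hb hb' h1
  exact ⟨h3, h4, h2⟩

/-- This precomputation keeps the test at order `N ^ 4`: later no scan over `w` is needed. Every
relevant cell of array `3` is written, so its previous contents do not matter. -/
theorem Runs.excludeTable {B N : ℕ} {s : State} {r : ℕ → ℕ → Prop} (hB : 1 < B) (hNB : N < B)
    (hN2 : N * N < B) (hN3 : N * N * N < B) (hn : s.reg 0 = N) (h : HoldsMatrix (s.arr 2) N r) :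
    Runs B excludeTable s (N * (N * (N * (6 + (N * 16 + 3) + 3) + 2 + 3) + 2 + 3) + 2)
      (fun s' => s'.reg 0 = N ∧ HoldsMatrix (s'.arr 2) N r ∧ HoldsTable (s'.arr 3) N r) := by
  classical
  refine (Runs.loop₃ (f := 1) (T := 6 + (N * 16 + 3))
    (fun k A _ => HoldsMatrix (A 2) N r ∧ ∀ a < N, ∀ b < N, ∀ u < N,
      (a * N + b) * N + u < k →
      A 3 ((a * N + b) * N + u) = if Excluded N r a b u then 1 else 0)
    hn (by omega) (by omega) (by omega) hB hNB ⟨h, by simp⟩ ?_).mono le_rfl ?_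
  · rintro a ha b hb c hc s₁ hs₁ h2 h3 h4 ⟨hM, hP⟩
    have h0 : s₁.reg 0 = N := by rw [hs₁ 0 (by omega) (by omega), hn]
    have hab := mul_add_lt_mul ha hb
    have habc := mul_add_lt_mul₃ ha hb hc
    refine Runs.cons ((Runs.search (Excludes r a b c) (T := 11) h0 hB hNB ?_).mono
      (T := N * 16 + 3) (by omega) ?_)
    · intro w hw s₂ hs₂ harr h6
      refine Runs.search_exclude hB hN2 ?_ (harr ▸ hM) ?_ ?_ ?_ ha hb hc h6 hw
      · rw [hs₂ 0 (by omega) (by omega), h0]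
      · rw [hs₂ 2 (by omega) (by omega), h2]
      · rw [hs₂ 3 (by omega) (by omega), h3]
      · rw [hs₂ 4 (by omega) (by omega), h4]
    · rintro s₂ ⟨hs₂, harr, h5'⟩
      have h5 : s₂.reg 5 = if Excluded N r a b c then 1 else 0 := by
        rw [h5']
        exact if_congr Iff.rfl rfl rfl
      have h0' : s₂.reg 0 = N := by rw [hs₂ 0 (by omega) (by omega), h0]
      have h2' : s₂.reg 2 = a := by rw [hs₂ 2 (by omega) (by omega), h2]
      have h3' : s₂.reg 3 = b := by rw [hs₂ 3 (by omega) (by omega), h3]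
      have h4' : s₂.reg 4 = c := by rw [hs₂ 4 (by omega) (by omega), h4]
      refine Runs.cons (Runs.mul (T := 0) (by simp [h0', h2']; omega) ?_)
      refine Runs.cons (Runs.add (T := 0) (by simp [h0', h2', h3']; omega) ?_)
      refine Runs.cons (Runs.mul (T := 0) (by simp [h0', h2', h3']; omega) ?_)
      refine Runs.cons (Runs.add (T := 0) (by simp [h0', h2', h3', h4']; omega) ?_)
      refine Runs.cons (Runs.store (T := 0) (by simp [h0', h2', h3', h4']; omega)
        (by simp [h5]; split_ifs <;> omega) ?_)
      refine Runs.nil (T := 0) ⟨?_, ?_, ?_⟩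
      · intro r hr _
        simp [show r ≠ 6 by omega, hs₂ r (by omega) (by omega)]
      · intro i hi j hj
        simpa [harr] using hM i hi j hj
      · intro a' ha' b' hb' c' hc' hlt
        simp only [arr_setCell, reg_setReg, arr_setReg, h0', h2', h3', h4', h5, harr]
        simp only [reduceIte, true_and, Nat.reduceEqDiff, OfNat.zero_ne_ofNat]
        by_cases heq : (a' * N + b') * N + c' = (a * N + b) * N + c
        · obtain ⟨rfl, rfl, rfl⟩ := mul_add_inj₃ hb' hc' hb hc heq
          rw [if_pos rfl]
        · rw [if_neg heq, hP a' ha' b' hb' c' hc' (by omega)]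
  · rintro s₁ ⟨h1, h2, h3⟩
    refine ⟨by rw [h1 0 (by omega) (by omega), hn], h2, fun a ha b hb c hc => ?_⟩
    exact h3 a ha b hb c hc (mul_add_lt_mul₃ ha hb hc)

/-- Element `u` is not excluded by the triangle `a`, `b`, `c`. -/
def Universal (N : ℕ) (r : ℕ → ℕ → Prop) (a b c u : ℕ) : Prop :=
  ¬ Excluded N r a b u ∧ ¬ Excluded N r b c u ∧
    ¬ Excluded N r a c u

/-- The triangle `a`, `b`, `c` has a universal element. -/
def Good (N : ℕ) (r : ℕ → ℕ → Prop) (a b c : ℕ) : Prop :=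
  r a b → r b c → r a c → ∃ u < N, Universal N r a b c u

/-- Make register `7` smaller than register `8` if no exclusion of element `reg 6` by two of
`reg 2`, `reg 3` and `reg 4` is in the table. -/
def universalBody : Prog :=
  block [loadTable 7 3 2 3 6 0, loadTable 8 3 3 4 6 0, loadTable 9 3 2 4 6 0, .add 7 7 8,
    .add 7 7 9, .const 8 1]

/-- Set register `1` to one if all triangles have universal elements, otherwise to zero. -/
def checkTriangles : Prog :=
  .seq (.const 1 1) (loop₃ 0 (block [
    search universalBody,
    loadMatrix 6 2 2 3 0, loadMatrix 7 2 3 4 0, loadMatrix 8 2 2 4 0, .mul 6 6 7, .mul 6 6 8,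
    .ifLt 5 6 (.const 1 0) .skip]))

/-- A sum of three table entries is below one exactly if all vanish; it is at most three, which fits
because of `hB`. -/
theorem Runs.search_universal {B N a b c : ℕ} {s : State} {r : ℕ → ℕ → Prop} (hB : 3 < B)
    (hN2 : N * N < B) (hN3 : N * N * N < B) (hn : s.reg 0 = N)
    (h : HoldsTable (s.arr 3) N r)
    (ha : s.reg 2 = a) (hb : s.reg 3 = b) (hc : s.reg 4 = c) (haN : a < N) (hbN : b < N)
    (hcN : c < N) {u : ℕ} (hu : s.reg 6 = u) (huN : u < N) :
    Runs B universalBody s 19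
      (fun s' => Agree 7 7 s s' ∧ s'.arr = s.arr ∧
        (s'.reg 7 < s'.reg 8 ↔ Universal N r a b c u)) := by
  classical
  have h01 : ∀ (p : Prop) [Decidable p], (if p then 1 else 0) < B :=
    fun p _ => by split_ifs <;> omega
  have h1 := mul_add_lt_mul haN hbN
  have h2 := mul_add_lt_mul hbN hcN
  have h3 := mul_add_lt_mul haN hcN
  have h4 := mul_add_lt_mul₃ haN hbN huN
  have h5 := mul_add_lt_mul₃ hbN hcN huN
  have h6 := mul_add_lt_mul₃ haN hcN huN
  refine Runs.cons (Runs.loadTable (T := 0) ha hb hu hn (by exact h a haN b hbN u huN) (by omega) (by omega)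
    (by omega) (by omega) (by omega) (h01 _) ?_)
  refine Runs.cons (Runs.loadTable (T := 0) (I := b) (J := c) (K := u) (N := N) (by simp [hb])
    (by simp [hc]) (by simp [hu]) (by simp [hn]) (by exact h b hbN c hcN u huN) (by omega) (by omega)
    (by omega) (by omega) (by omega) (h01 _) ?_)
  refine Runs.cons (Runs.loadTable (T := 0) (I := a) (J := c) (K := u) (N := N) (by simp [ha])
    (by simp [hc]) (by simp [hu]) (by simp [hn]) (by exact h a haN c hcN u huN) (by omega) (by omega)
    (by omega) (by omega) (by omega) (h01 _) ?_)
  refine Runs.cons (Runs.add (T := 0) (by simp; split_ifs <;> omega) ?_)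
  refine Runs.cons (Runs.add (T := 0) (by simp; split_ifs <;> omega) ?_)
  refine Runs.cons (Runs.const (T := 0) (by omega) ?_)
  refine Runs.nil (T := 0) ⟨?_, rfl, ?_⟩
  · intro r hr _
    simp [show r ≠ 7 by omega, show r ≠ 8 by omega, show r ≠ 9 by omega]
  · unfold Universal
    by_cases h1 : Excluded N r a b u <;> by_cases h2 : Excluded N r b c u <;>
      by_cases h3 : Excluded N r a c u <;> simp [h1, h2, h3]

open Classical in
theorem Runs.checkTriangles {B N : ℕ} {s : State} {r : ℕ → ℕ → Prop} (hB : 3 < B) (hNB : N < B)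
    (hN2 : N * N < B) (hN3 : N * N * N < B) (hn : s.reg 0 = N) (h : HoldsMatrix (s.arr 2) N r)
    (hT : HoldsTable (s.arr 3) N r) :
    Runs B checkTriangles s (1 + (N * (N * (N * (14 + (N * 24 + 3) + 3) + 2 + 3) + 2 + 3) + 2))
      (fun s' => s'.reg 1 =
        if ∀ a < N, ∀ b < N, ∀ c < N, Good N r a b c then 1 else 0) := by
  refine Runs.seq (Runs.const (T := 0) (by omega) ?_)
  refine (Runs.loop₃ (s := s.setReg 1 1) (f := 1) (T := 14 + (N * 24 + 3)) (N := N)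
    (fun k A f => HoldsMatrix (A 2) N r ∧ HoldsTable (A 3) N r ∧
      f = if ∀ a < N, ∀ b < N, ∀ c < N, (a * N + b) * N + c < k → Good N r a b c then 1 else 0)
    (by simpa using hn) (by omega) (by omega) (by omega) (by omega) hNB
    ⟨h, hT, by simp⟩ ?_).mono le_rfl ?_
  · rintro a ha b hb c hc s₁ hs₁ h2 h3 h4 ⟨hM, hT, hP⟩
    have h0 : s₁.reg 0 = N := by
      rw [hs₁ 0 (by omega) (by omega)]
      simpa using hn
    have h1 := mul_add_lt_mul ha hb
    have h1' := mul_add_lt_mul hb hc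
    have h1'' := mul_add_lt_mul ha hc
    have h01 : ∀ (p : Prop) [Decidable p], (if p then 1 else 0) < B :=
    fun p _ => by split_ifs <;> omega
    refine Runs.cons ((Runs.search (Universal N r a b c) (T := 19) h0 (by omega) hNB ?_).mono
      (T := N * 24 + 3) (by omega) ?_)
    · intro u hu s₂ hs₂ harr h6
      refine Runs.search_universal hB hN2 hN3 ?_ (harr ▸ hT) ?_ ?_ ?_ ha hb hc h6 hu
      · rw [hs₂ 0 (by omega) (by omega), h0]
      · rw [hs₂ 2 (by omega) (by omega), h2]
      · rw [hs₂ 3 (by omega) (by omega), h3]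
      · rw [hs₂ 4 (by omega) (by omega), h4]
    · rintro s₂ ⟨hs₂, harr, h5⟩
      have hr1 := hs₂ 1 (by omega) (by omega)
      have h0' : s₂.reg 0 = N := by rw [hs₂ 0 (by omega) (by omega), h0]
      have h2' : s₂.reg 2 = a := by rw [hs₂ 2 (by omega) (by omega), h2]
      have h3' : s₂.reg 3 = b := by rw [hs₂ 3 (by omega) (by omega), h3]
      have h4' : s₂.reg 4 = c := by rw [hs₂ 4 (by omega) (by omega), h4]
      rw [← harr] at hM hT
      refine Runs.cons (Runs.loadMatrix (T := 0) h2' h3' h0' (by exact hM a ha b hb) (by omega) (by omega)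
        (h01 _) ?_)
      refine Runs.cons (Runs.loadMatrix (T := 0) (I := b) (J := c) (N := N) (by simp [h3'])
        (by simp [h4']) (by simp [h0']) (by exact hM b hb c hc) (by omega) (by omega) (h01 _) ?_)
      refine Runs.cons (Runs.loadMatrix (T := 0) (I := a) (J := c) (N := N) (by simp [h2'])
        (by simp [h4']) (by simp [h0']) (by exact hM a ha c hc) (by omega) (by omega) (h01 _) ?_)
      refine Runs.cons (Runs.mul (T := 0) (by simp; split_ifs <;> omega) ?_)
      refine Runs.cons (Runs.mul (T := 0) (by simp; split_ifs <;> omega) ?_)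
      have hiff : (∀ a' < N, ∀ b' < N, ∀ c' < N, (a' * N + b') * N + c' < (a * N + b) * N + c + 1 →
          Good N r a' b' c') ↔ (∀ a' < N, ∀ b' < N, ∀ c' < N,
          (a' * N + b') * N + c' < (a * N + b) * N + c → Good N r a' b' c') ∧
            Good N r a b c := by
        constructor
        · intro h
          exact ⟨fun a' ha' b' hb' c' hc' hlt => h a' ha' b' hb' c' hc' (by omega),
            h a ha b hb c hc (by omega)⟩
        · rintro ⟨h1, h2⟩ a' ha' b' hb' c' hc' hlt
          by_cases heq : (a' * N + b') * N + c' = (a * N + b) * N + c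
          · obtain ⟨rfl, rfl, rfl⟩ := mul_add_inj₃ hb' hc' hb hc heq
            exact h2
          · exact h1 a' ha' b' hb' c' hc' (by omega)
      -- Register `6` is the product of the three matrix entries and register `5` the search flag.
      -- The test succeeds exactly for a triangle without universal element.
      refine Runs.cons (T₁ := 2) (Runs.ifLt (fun hlt => Runs.const (T := 0) (by omega)
        (Runs.nil (T := 0) ⟨?_, hM, hT, ?_⟩))
        (fun hlt => Runs.skip (T := 0) (Runs.nil (T := 0) ⟨?_, hM, hT, ?_⟩)))
      · intro r hr hr1
        simp [show r ≠ 6 by omega, show r ≠ 7 by omega, show r ≠ 8 by omega, hr1,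
          hs₂ r (by omega) (by omega)]
      · have hg : ¬ Good N r a b c := by
          intro hg
          simp [h5] at hlt
          by_cases k1 : r a b <;> by_cases k2 : r b c <;> by_cases k3 : r a c <;>
            simp [k1, k2, k3] at hlt
          obtain ⟨u, hu, hg⟩ := hg k1 k2 k3
          exact hlt u hu hg
        rw [if_neg (fun h => hg (hiff.1 h).2)]
        simp
      · intro r hr hr1
        simp [show r ≠ 6 by omega, show r ≠ 7 by omega, show r ≠ 8 by omega,
          hs₂ r (by omega) (by omega)]
      · have hg : Good N r a b c := by
          intro k1 k2 k3
          by_contra hne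
          simp [h5, k1, k2, k3, hne] at hlt
        simp only [hiff, hg, and_true]
        simp [hr1, hP]
  · rintro s₁ ⟨-, -, -, h3⟩
    rw [h3]
    refine if_congr ⟨?_, ?_⟩ rfl rfl
    · intro h a ha b hb c hc
      exact h a ha b hb c hc (mul_add_lt_mul₃ ha hb hc)
    · intro h a ha b hb c hc _
      exact h a ha b hb c hc

theorem forall_good_iff {N : ℕ} {r : ℕ → ℕ → Prop} (hsymm : ∀ i j, r i j → r j i)
    (hlt : ∀ i j, r i j → i < N) :
    (∀ a < N, ∀ b < N, ∀ c < N, Good N r a b c) ↔ TriangleHelly r := by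
  constructor
  · intro h a b c hab hbc hac
    obtain ⟨u, -, h1, h2, h3⟩ := h a (hlt _ _ hab) b (hlt _ _ hbc) c (hlt _ _ (hsymm _ _ hac))
      hab hbc hac
    refine ⟨u, fun w hw => ?_⟩
    by_contra hwu
    have huw : ¬ r u w := fun h => hwu (hsymm _ _ h)
    rcases hw with ⟨k1, k2⟩ | ⟨k1, k2⟩ | ⟨k1, k2⟩
    · exact h1 ⟨w, hlt _ _ k1, hsymm _ _ k1, hsymm _ _ k2, huw⟩
    · exact h2 ⟨w, hlt _ _ k1, hsymm _ _ k1, hsymm _ _ k2, huw⟩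
    · exact h3 ⟨w, hlt _ _ k1, hsymm _ _ k1, hsymm _ _ k2, huw⟩
  · intro h a ha b hb c hc hab hbc hac
    obtain ⟨u, hu⟩ := h a b c hab hbc hac
    -- Since `b` is related to `a` and `c`, it is related to `u`, which bounds `u` by `N`. Using `b`
    -- itself as `w` this way needs no reflexivity.
    have hau : r b u := hu b (by
      exact Or.inr (Or.inr ⟨hsymm _ _ hab, hbc⟩))
    refine ⟨u, hlt _ _ (hsymm _ _ hau), ?_, ?_, ?_⟩
    · rintro ⟨w, -, k1, k2, k3⟩
      exact k3 (hsymm _ _ (hu w (Or.inl ⟨hsymm _ _ k1, hsymm _ _ k2⟩)))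
    · rintro ⟨w, -, k1, k2, k3⟩
      exact k3 (hsymm _ _ (hu w (Or.inr (Or.inl ⟨hsymm _ _ k1, hsymm _ _ k2⟩))))
    · rintro ⟨w, -, k1, k2, k3⟩
      exact k3 (hsymm _ _ (hu w (Or.inr (Or.inr ⟨hsymm _ _ k1, hsymm _ _ k2⟩))))

/-- The test whether the graph with the adjacency matrix in array `2` is clique-Helly. -/
def cliqueHellyTest : Prog :=
  .seq closeDiagonal (.seq excludeTable (.seq checkTriangles (.seq (.const 2 0) (.add 0 1 2))))

theorem Runs.cliqueHellyTest {B N : ℕ} (H : SimpleGraph (Fin N)) {s : State} (hB : 3 < B)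
    (hNB : N < B) (hN2 : N * N < B) (hN3 : N * N * N < B) (hs : HoldsGraph H s) :
    Runs B cliqueHellyTest s (100 * (N ^ 4 + 1))
      (fun s' => Answers s' H.cliqueHypergraph.IsHelly) := by
  classical
  obtain ⟨hn, hM⟩ := hs
  have hB1 : 1 < B := by omega
  let h : ℕ → ℕ → Prop := fun i j => ∃ (hi : i < N) (hj : j < N), H.Adj ⟨i, hi⟩ ⟨j, hj⟩
  -- The conjunct `i < N` keeps numbers outside the graph from being related to themselves.
  let r : ℕ → ℕ → Prop := fun i j => i < N ∧ (i = j ∨ h i j)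
  have hM' : HoldsMatrix (s.arr 2) N h := by
    intro i hi j hj
    rw [hM ⟨i, hi⟩ ⟨j, hj⟩]
    simp [h, hi, hj]
  have hsymm : ∀ i j, r i j → r j i := by
    rintro i j ⟨hi, rfl | ⟨hi', hj', hij⟩⟩
    · exact ⟨hi, Or.inl rfl⟩
    · exact ⟨hj', Or.inr ⟨hj', hi', hij.symm⟩⟩
  have hiff : (∀ a < N, ∀ b < N, ∀ c < N, Good N r a b c) ↔ H.cliqueHypergraph.IsHelly := by
    rw [forall_good_iff hsymm (fun i j h => h.1), H.cliqueHypergraph_isHelly_iff,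
      ← triangleHelly_onFun_iff (fun i : Fin N => (i : ℕ)) hsymm
        (fun a b h => ⟨h.1, Or.inl rfl⟩) (fun a h => ⟨⟨a, h.1⟩, rfl⟩)]
    refine iff_of_eq (congrArg TriangleHelly ?_)
    funext i j
    simp [r, h, Fin.ext_iff]
  refine (Runs.seq ((Runs.closeDiagonal hB1 hNB hN2 hn hM').mono le_rfl ?_)).mono
    (R := fun s' => Answers s' H.cliqueHypergraph.IsHelly)
    (T₁ := (N * 8 + 2) + ((N * (N * (N * (6 + (N * 16 + 3) + 3) + 2 + 3) + 2 + 3) + 2) +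
      ((1 + (N * (N * (N * (14 + (N * 24 + 3) + 3) + 2 + 3) + 2 + 3) + 2)) + (1 + 1))))
    ?_ (fun _ h => h)
  · rintro s₁ ⟨h1, h2⟩
    have h2' : HoldsMatrix (s₁.arr 2) N r := by
      exact h2.congr fun i hi j _ => ⟨fun k => ⟨hi, k⟩, fun k => k.2⟩
    refine Runs.seq ((Runs.excludeTable hB1 hNB hN2 hN3 h1 h2').mono le_rfl ?_)
    rintro s₂ ⟨h3, h4, h5⟩
    refine Runs.seq ((Runs.checkTriangles hB hNB hN2 hN3 h3 h4 h5).mono le_rfl ?_)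
    intro s₃ h6
    refine Runs.seq (Runs.const (T := 0) (by omega) (Runs.add (T := 0) ?_ ?_))
    · simp [h6]
      split_ifs <;> omega
    · constructor
      · intro hH
        simp [h6, if_pos (hiff.2 hH)]
      · intro hH
        simp [h6, if_neg (mt hiff.1 hH)]
  -- The coefficients of `N ^ 4`, `N ^ 3`, `N ^ 2` and `N` in the step count are 40, 32, 10 and 18,
  -- with sum 100. The added one covers `N = 0`.
  · have hpow : ∀ k ≤ 4, N ^ k ≤ N ^ 4 + 1 := by
      intro k hk
      rcases Nat.eq_zero_or_pos N with rfl | hN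
      · rcases Nat.eq_zero_or_pos k with rfl | hk
        · simp
        · simp [hk.ne']
      · exact (Nat.pow_le_pow_right hN hk).trans (Nat.le_succ _)
    have h1 := hpow 1 (by omega)
    have h2 := hpow 2 (by omega)
    have h3 := hpow 3 (by omega)
    ring_nf at h1 ⊢
    omega

end RAM

/-! ### Building the biclique line graph -/

namespace RAM

open State

/-- Write the adjacency matrix of the graph given by the arrays `0` and `1` to array `3`. -/
def fillAdjacency : Prog :=
  forLoop 2 1 (block [.load 4 0 2, .load 5 1 2, .mul 6 4 0, .add 6 6 5, .const 7 1, .store 3 6 7,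
    .mul 6 5 0, .add 6 6 4, .store 3 6 7])

section Build

variable {n m : ℕ} {G : SimpleGraph (Fin n)}

/-- The arrays `0` and `1` hold the edge list, register `0` the number of vertices. -/
def HoldsEdges (L : EdgeList G m) (A : ℕ → ℕ → ℕ) (v : ℕ) : Prop :=
  v = n ∧ (∀ i : Fin m, A 0 i = L.fst i) ∧ ∀ i : Fin m, A 1 i = L.snd i

open Classical in
/-- The list `A` starts with the adjacency matrix of `G`. -/
def HoldsAdjacency (G : SimpleGraph (Fin n)) (A : ℕ → ℕ) : Prop :=
  ∀ u v : Fin n, A (u * n + v) = if G.Adj u v then 1 else 0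

/-- The `i`-th edge of the list joins `u` and `v`. -/
def EdgeList.Joins (L : EdgeList G m) (i : Fin m) (u v : Fin n) : Prop :=
  u = L.fst i ∧ v = L.snd i ∨ u = L.snd i ∧ v = L.fst i

theorem EdgeList.exists_joins_iff (L : EdgeList G m) (u v : Fin n) :
    (∃ i, L.Joins i u v) ↔ G.Adj u v := by
  constructor
  · rintro ⟨i, ⟨rfl, rfl⟩ | ⟨rfl, rfl⟩⟩
    · exact L.adj i
    · exact (L.adj i).symm
  · intro h
    obtain ⟨i, hi⟩ := L.bijective.2 ⟨s(u, v), h⟩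
    have hi' : s(L.fst i, L.snd i) = s(u, v) := congrArg Subtype.val hi
    rcases Sym2.eq_iff.1 hi' with ⟨h1, h2⟩ | ⟨h1, h2⟩
    · exact ⟨i, Or.inl ⟨h1.symm, h2.symm⟩⟩
    · exact ⟨i, Or.inr ⟨h2.symm, h1.symm⟩⟩

theorem fin_mul_add_eq_iff {u v u' v' : Fin n} :
    (u * n + v : ℕ) = u' * n + v' ↔ u = u' ∧ v = v' := by
  constructor
  · intro h
    obtain ⟨h1, h2⟩ := mul_add_inj v.2 v'.2 h
    exact ⟨Fin.ext h1, Fin.ext h2⟩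
  · rintro ⟨rfl, rfl⟩
    rfl

/-- Only the two entries of each listed edge are written, so the time is linear in `m` and
independent of `n`. The entries of non-edges are correct because array `3` is zero in `L.input`. -/
theorem Runs.fillAdjacency {B : ℕ} (L : EdgeList G m) (hB : 1 < B) (hn : n < B) (hm : m < B)
    (hn2 : n * n < B) :
    Runs B fillAdjacency L.input (m * 13 + 2)
      (fun s => s.reg 1 = m ∧ HoldsEdges L s.arr (s.reg 0) ∧ HoldsAdjacency G (s.arr 3)) := by
  classical
  refine (Runs.forLoop (s := L.input) (f := 0) (T := 10) (N := m)
    (fun k A v => HoldsEdges L A v ∧ ∀ u v : Fin n, A 3 (u * n + v) =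
      if ∃ i : Fin m, (i : ℕ) < k ∧ L.Joins i u v then 1 else 0)
    rfl (by omega) (by omega) (by omega) hB hm ?_ ?_).mono le_rfl ?_
  · refine ⟨⟨rfl, fun i => ?_, fun i => ?_⟩, fun u v => ?_⟩ <;> simp [EdgeList.input]
  · rintro k hk s hs h2 ⟨⟨h0, hf, hg⟩, hP⟩
    have hfk : s.arr 0 k = L.fst ⟨k, hk⟩ := hf ⟨k, hk⟩
    have hgk : s.arr 1 k = L.snd ⟨k, hk⟩ := hg ⟨k, hk⟩
    generalize hu : L.fst ⟨k, hk⟩ = u at hfk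
    generalize hv : L.snd ⟨k, hk⟩ = v at hgk
    have h1 := mul_add_lt_mul u.2 v.2
    have h1' := mul_add_lt_mul v.2 u.2
    have hun := u.2
    have hvn := v.2
    refine Runs.cons (Runs.load (T := 0) (by simp [h2, hfk]; omega) ?_)
    refine Runs.cons (Runs.load (T := 0) (by simp [h2, hgk]; omega) ?_)
    refine Runs.cons (Runs.mul (T := 0) (by simp [h0, h2, hfk]; omega) ?_)
    refine Runs.cons (Runs.add (T := 0) (by simp [h0, h2, hfk, hgk]; omega) ?_)
    refine Runs.cons (Runs.const (T := 0) hB ?_)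
    refine Runs.cons (Runs.store (T := 0) (by simp [h0, h2, hfk, hgk]; omega)
      (by simpa using hB) ?_)
    refine Runs.cons (Runs.mul (T := 0) (by simp [h0, h2, hgk]; omega) ?_)
    refine Runs.cons (Runs.add (T := 0) (by simp [h0, h2, hfk, hgk]; omega) ?_)
    refine Runs.cons (Runs.store (T := 0) (by simp [h0, h2, hfk, hgk]; omega)
      (by simpa using hB) ?_)
    refine Runs.nil (T := 0) ⟨?_, ⟨?_, ?_, ?_⟩, ?_⟩
    · intro r hr _
      simp [show r ≠ 4 by omega, show r ≠ 5 by omega, show r ≠ 6 by omega, show r ≠ 7 by omega]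
    · simpa using h0
    · intro i
      simpa using hf i
    · intro i
      simpa using hg i
    · intro u' v'
      have hiff : (∃ i : Fin m, (i : ℕ) < k + 1 ∧ L.Joins i u' v') ↔
          (u' = v ∧ v' = u) ∨ (u' = u ∧ v' = v) ∨ ∃ i : Fin m, (i : ℕ) < k ∧ L.Joins i u' v' := by
        have hk' : L.Joins ⟨k, hk⟩ u' v' ↔ (u' = u ∧ v' = v) ∨ (u' = v ∧ v' = u) := by
          rw [EdgeList.Joins, hu, hv]
        constructor
        · rintro ⟨i, hi, hJ⟩
          by_cases hik : (i : ℕ) = k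
          · obtain rfl : i = ⟨k, hk⟩ := Fin.ext hik
            have := hk'.1 hJ
            tauto
          · exact Or.inr (Or.inr ⟨i, by omega, hJ⟩)
        · rintro (h | h | ⟨i, hi, hJ⟩)
          · exact ⟨⟨k, hk⟩, by simp, hk'.2 (Or.inr h)⟩
          · exact ⟨⟨k, hk⟩, by simp, hk'.2 (Or.inl h)⟩
          · exact ⟨i, by omega, hJ⟩
      rw [if_congr hiff rfl rfl]
      simp [h0, h2, hfk, hgk, fin_mul_add_eq_iff, hP]
      by_cases c1 : u' = v ∧ v' = u
      · simp [c1]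
      · by_cases c2 : u' = u ∧ v' = v
        · simp [c2]
        · simp [c1, c2]
  · rintro s ⟨h1, h2, h3⟩
    refine ⟨h1 1 (by omega) (by omega), h2, fun u v => ?_⟩
    rw [h3 u v]
    refine if_congr ?_ rfl rfl
    rw [← L.exists_joins_iff]
    exact ⟨fun ⟨i, _, h⟩ => ⟨i, h⟩, fun ⟨i, h⟩ => ⟨i, i.2, h⟩⟩

/-- Write the adjacency matrix of the biclique line graph to array `2`. -/
def fillLineGraph : Prog :=
  loop₂ 1 (block [.load 4 0 2, .load 5 1 2, .load 6 0 3, .load 7 1 3,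
    loadMatrix 8 3 4 6 0, loadMatrix 9 3 4 7 0, loadMatrix 10 3 5 6 0, loadMatrix 11 3 5 7 0,
    .mul 12 9 10, .add 13 8 11, .sub 12 12 13, .mul 13 8 11, .add 14 9 10, .sub 13 13 14,
    .add 12 12 13, .ifLt 2 3 .skip (.ifLt 3 2 .skip (.const 12 0)),
    .mul 13 2 1, .add 13 13 3, .store 2 13 12])

theorem EdgeList.comap_bicliqueLineGraph_adj_iff (L : EdgeList G m) (i j : Fin m) :
    (G.bicliqueLineGraph.comap L.edge).Adj i j ↔ i ≠ j ∧
      (G.Aligned (L.fst i) (L.snd i) (L.fst j) (L.snd j) ∨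
        G.Aligned (L.fst i) (L.snd i) (L.snd j) (L.fst j)) := by
  rw [← SimpleGraph.edgeBicliqueHypergraph_adj_mk_iff G (L.adj i) (L.adj j)]
  have h := L.eq_or_bicliqueLineGraph_adj_iff i j
  constructor
  · intro hij
    exact ⟨hij.ne, h.1 (Or.inr hij)⟩
  · rintro ⟨hne, hij⟩
    exact (h.2 hij).resolve_left hne

theorem Runs.fillLineGraph {B : ℕ} (L : EdgeList G m) {s : State} (hB : 3 < B) (hn : n < B)
    (hm : m < B) (hn2 : n * n < B) (hm2 : m * m < B) (h1 : s.reg 1 = m)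
    (hL : HoldsEdges L s.arr (s.reg 0)) (hG : HoldsAdjacency G (s.arr 3)) :
    Runs B fillLineGraph s (m * (m * 33 + 2 + 3) + 2)
      (fun s => s.reg 1 = m ∧ HoldsAdjacency (G.bicliqueLineGraph.comap L.edge) (s.arr 2)) := by
  classical
  refine (Runs.loop₂ (s := s) (f := 0) (T := 30) (N := m)
    (fun k A v => HoldsEdges L A v ∧ HoldsAdjacency G (A 3) ∧
      ∀ i j : Fin m, (i * m + j : ℕ) < k → A 2 (i * m + j) =
        if (G.bicliqueLineGraph.comap L.edge).Adj i j then 1 else 0)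
    h1 (by omega) (by omega) (by omega) (by omega) hm ⟨hL, hG, by simp⟩ ?_).mono le_rfl ?_
  · rintro a ha b hb s₁ hs₁ h2 h3 ⟨⟨h0, hf, hg⟩, hG, hP⟩
    have h01 : ∀ (p : Prop) [Decidable p], (if p then 1 else 0) < B :=
      fun p _ => by split_ifs <;> omega
    have h1' : s₁.reg 1 = m := by rw [hs₁ 1 (by omega) (by omega), h1]
    have hfa : s₁.arr 0 a = L.fst ⟨a, ha⟩ := hf ⟨a, ha⟩
    have hga : s₁.arr 1 a = L.snd ⟨a, ha⟩ := hg ⟨a, ha⟩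
    have hfb : s₁.arr 0 b = L.fst ⟨b, hb⟩ := hf ⟨b, hb⟩
    have hgb : s₁.arr 1 b = L.snd ⟨b, hb⟩ := hg ⟨b, hb⟩
    have hadj := L.comap_bicliqueLineGraph_adj_iff ⟨a, ha⟩ ⟨b, hb⟩
    generalize L.fst ⟨a, ha⟩ = p at hfa hadj
    generalize L.snd ⟨a, ha⟩ = q at hga hadj
    generalize L.fst ⟨b, hb⟩ = x at hfb hadj
    generalize L.snd ⟨b, hb⟩ = y at hgb hadj
    have hp := p.2
    have hq := q.2
    have hx := x.2
    have hy := y.2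
    have hpx := mul_add_lt_mul hp hx
    have hpy := mul_add_lt_mul hp hy
    have hqx := mul_add_lt_mul hq hx
    have hqy := mul_add_lt_mul hq hy
    have hab := mul_add_lt_mul ha hb
    refine Runs.cons (Runs.load (T := 0) (by simp [h2, hfa]; omega) ?_)
    refine Runs.cons (Runs.load (T := 0) (by simp [h2, hga]; omega) ?_)
    refine Runs.cons (Runs.load (T := 0) (by simp [h3, hfb]; omega) ?_)
    refine Runs.cons (Runs.load (T := 0) (by simp [h3, hgb]; omega) ?_)
    refine Runs.cons (Runs.loadMatrix (T := 0) (I := p) (J := x) (N := n) (by simp [h2, hfa])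
      (by simp [h3, hfb]) (by simp [h0]) (by exact hG p x) (by omega) (by omega) (h01 _) ?_)
    refine Runs.cons (Runs.loadMatrix (T := 0) (I := p) (J := y) (N := n) (by simp [h2, hfa])
      (by simp [h3, hgb]) (by simp [h0]) (by exact hG p y) (by omega) (by omega) (h01 _) ?_)
    refine Runs.cons (Runs.loadMatrix (T := 0) (I := q) (J := x) (N := n) (by simp [h2, hga])
      (by simp [h3, hfb]) (by simp [h0]) (by exact hG q x) (by omega) (by omega) (h01 _) ?_)
    refine Runs.cons (Runs.loadMatrix (T := 0) (I := q) (J := y) (N := n) (by simp [h2, hga])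
      (by simp [h3, hgb]) (by simp [h0]) (by exact hG q y) (by omega) (by omega) (h01 _) ?_)
    generalize hs₂ : State.setReg _ 11 _ = s₂
    have hs₂' : Agree 4 4 s₁ s₂ := by
      intro r hr _
      subst hs₂
      simp [show r ≠ 4 by omega, show r ≠ 5 by omega, show r ≠ 6 by omega, show r ≠ 7 by omega,
        show r ≠ 8 by omega, show r ≠ 9 by omega, show r ≠ 10 by omega, show r ≠ 11 by omega]
    have harr : s₂.arr = s₁.arr := by
      subst hs₂
      rfl
    have e8 : s₂.reg 8 = if G.Adj p x then 1 else 0 := by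
      subst hs₂
      simp
    have e9 : s₂.reg 9 = if G.Adj p y then 1 else 0 := by
      subst hs₂
      simp
    have e10 : s₂.reg 10 = if G.Adj q x then 1 else 0 := by
      subst hs₂
      simp
    have e11 : s₂.reg 11 = if G.Adj q y then 1 else 0 := by
      subst hs₂
      simp
    clear hs₂
    have b8 : s₂.reg 8 ≤ 1 := by rw [e8]; split_ifs <;> omega
    have b9 : s₂.reg 9 ≤ 1 := by rw [e9]; split_ifs <;> omega
    have b10 : s₂.reg 10 ≤ 1 := by rw [e10]; split_ifs <;> omega
    have b11 : s₂.reg 11 ≤ 1 := by rw [e11]; split_ifs <;> omega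
    have m1 : s₂.reg 9 * s₂.reg 10 ≤ 1 := Nat.mul_le_mul b9 b10
    have m2 : s₂.reg 8 * s₂.reg 11 ≤ 1 := Nat.mul_le_mul b8 b11
    refine Runs.cons (Runs.mul (T := 0) (by omega) ?_)
    refine Runs.cons (Runs.add (T := 0) (by simp; omega) ?_)
    refine Runs.cons (Runs.sub (T := 0) (by simp; omega) ?_)
    refine Runs.cons (Runs.mul (T := 0) (by simp; omega) ?_)
    refine Runs.cons (Runs.add (T := 0) (by simp; omega) ?_)
    refine Runs.cons (Runs.sub (T := 0) (by simp; omega) ?_)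
    refine Runs.cons (Runs.add (T := 0) (by simp; omega) ?_)
    generalize hs₃ : State.setReg _ 12 _ = s₃
    have hs₃' : Agree 4 4 s₁ s₃ := by
      intro r hr hr4
      rw [← hs₂' r hr hr4]
      subst hs₃
      simp [show r ≠ 12 by omega, show r ≠ 13 by omega, show r ≠ 14 by omega]
    have harr' : s₃.arr = s₁.arr := by
      rw [← harr]
      subst hs₃
      rfl
    -- With truncated subtraction, `py * qx - (px + qy)` is one exactly for the first alignment and
    -- otherwise zero; the other summand does the same for the second. The two alignments exclude
    -- each other.
    have e12 : s₃.reg 12 = if G.Aligned p q x y ∨ G.Aligned p q y x then 1 else 0 := by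
      subst hs₃
      simp [e8, e9, e10, e11]
      unfold SimpleGraph.Aligned
      by_cases c1 : G.Adj p x <;> by_cases c2 : G.Adj p y <;> by_cases c3 : G.Adj q x <;>
        by_cases c4 : G.Adj q y <;> simp [c1, c2, c3, c4]
    clear hs₃
    have f1 : s₃.reg 1 = m := by rw [hs₃' 1 (by omega) (by omega), h1']
    have f2 : s₃.reg 2 = a := by rw [hs₃' 2 (by omega) (by omega), h2]
    have f3 : s₃.reg 3 = b := by rw [hs₃' 3 (by omega) (by omega), h3]
    -- An edge is aligned with itself, so the diagonal entry computed so far is one and has to be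
    -- cleared.
    have hdiag : Runs B (.ifLt 2 3 .skip (.ifLt 3 2 .skip (.const 12 0))) s₃ 3
        (fun s₄ => Agree 4 4 s₁ s₄ ∧ s₄.arr = s₁.arr ∧ s₄.reg 12 =
          if (G.bicliqueLineGraph.comap L.edge).Adj ⟨a, ha⟩ ⟨b, hb⟩ then 1 else 0) := by
      have hne : a ≠ b → s₃.reg 12 =
          if (G.bicliqueLineGraph.comap L.edge).Adj ⟨a, ha⟩ ⟨b, hb⟩ then 1 else 0 := by
        intro hne
        rw [e12]
        refine if_congr ?_ rfl rfl
        rw [hadj]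
        simp [hne]
      refine Runs.ifLt (fun h => Runs.skip ⟨hs₃', harr', hne (by omega)⟩)
        (fun h => Runs.ifLt (fun h => Runs.skip ⟨hs₃', harr', hne (by omega)⟩)
          (fun h' => Runs.const (by omega) ⟨?_, harr', ?_⟩))
      · intro r hr hr4
        simp [show r ≠ 12 by omega, hs₃' r hr hr4]
      · rw [if_neg]
        · simp
        · rw [hadj]
          rintro ⟨hne, -⟩
          exact hne (Fin.ext (by simp only; omega))
    refine Runs.cons (hdiag.mono le_rfl ?_)
    rintro s₄ ⟨hs₄, harr₄, e12'⟩
    have g1 : s₄.reg 1 = m := by rw [hs₄ 1 (by omega) (by omega), h1']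
    have g2 : s₄.reg 2 = a := by rw [hs₄ 2 (by omega) (by omega), h2]
    have g3 : s₄.reg 3 = b := by rw [hs₄ 3 (by omega) (by omega), h3]
    refine Runs.cons (Runs.mul (T := 0) (by simp [g1, g2]; omega) ?_)
    refine Runs.cons (Runs.add (T := 0) (by simp [g1, g2, g3]; omega) ?_)
    refine Runs.cons (Runs.store (T := 0) (by simp [g1, g2, g3]; omega)
      (by simp only [reg_setReg, e12', reduceIte, Nat.reduceEqDiff]; exact h01 _) ?_)
    refine Runs.nil (T := 0) ⟨?_, ⟨?_, ?_, ?_⟩, ?_, ?_⟩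
    · intro r hr hr0
      simp [show r ≠ 13 by omega, hs₄ r (by omega) (by omega)]
    · simp [hs₄ 0 (by omega) (by omega), h0]
    · intro i
      simpa [harr₄] using hf i
    · intro i
      simpa [harr₄] using hg i
    · intro u v
      simpa [harr₄] using hG u v
    · intro i j hij
      by_cases heq : (i * m + j : ℕ) = a * m + b
      · obtain ⟨h5, h6⟩ := mul_add_inj j.2 hb heq
        obtain rfl : i = ⟨a, ha⟩ := Fin.ext h5
        obtain rfl : j = ⟨b, hb⟩ := Fin.ext h6
        simp only [arr_setCell, reg_setReg, arr_setReg, g1, g2, g3, reduceIte, true_and,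
          Nat.reduceEqDiff, e12']
      · rw [← hP i j (by omega)]
        simp [g1, g2, g3, heq, harr₄]
  · rintro s₁ ⟨h2, -, -, h3⟩
    exact ⟨by rw [h2 1 (by omega) (by omega), h1], fun i j => h3 i j (mul_add_lt_mul i.2 j.2)⟩

/-- The construction of the biclique line graph. -/
def buildLineGraph : Prog :=
  .seq fillAdjacency (.seq fillLineGraph (.seq (.const 2 0) (.add 0 1 2)))

theorem Runs.buildLineGraph {B : ℕ} (L : EdgeList G m) (hB : 3 < B) (hn : n < B)
    (hm : m < B) (hn2 : n * n < B) (hm2 : m * m < B) :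
    Runs B buildLineGraph L.input (60 * (m ^ 2 + 1))
      (fun s => HoldsGraph (G.bicliqueLineGraph.comap L.edge) s) := by
  refine (Runs.seq ((Runs.fillAdjacency L (by omega) hn hm hn2).mono le_rfl ?_)).mono
    (R := fun s => HoldsGraph (G.bicliqueLineGraph.comap L.edge) s)
    (T₁ := (m * 13 + 2) + ((m * (m * 33 + 2 + 3) + 2) + (1 + 1))) ?_ (fun _ h => h)
  · rintro s₁ ⟨h1, h2, h3⟩
    refine Runs.seq ((Runs.fillLineGraph L hB hn hm hn2 hm2 h1 h2 h3).mono le_rfl ?_)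
    rintro s₂ ⟨h4, h5⟩
    refine Runs.seq (Runs.const (T := 0) (by omega) (Runs.add (T := 0) ?_ ⟨?_, h5⟩))
    · simpa [h4] using hm
    · simp [h4]
  · nlinarith [Nat.le_self_pow (n := 2) (by omega) m]

end Build

/-! ### Word size and assembly -/

/-- The largest addresses are those of the table, below `N ^ 3`. The summand two makes room for the
constants even if the graph is empty. -/
theorem lt_add_two_pow_four {N M : ℕ} (h : N ≤ M) :
    3 < (M + 2) ^ 4 ∧ N < (M + 2) ^ 4 ∧ N * N < (M + 2) ^ 4 ∧ N * N * N < (M + 2) ^ 4 := by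
  have h16 : 2 ^ 4 ≤ (M + 2) ^ 4 := Nat.pow_le_pow_left (by omega) 4
  have h1 : N ^ 1 < (M + 2) ^ 4 :=
    (Nat.pow_lt_pow_left (by omega) (by omega)).trans_le (Nat.pow_le_pow_right (by omega)
      (by omega : 1 ≤ 4))
  have h2 : N ^ 2 < (M + 2) ^ 4 :=
    (Nat.pow_lt_pow_left (by omega) (by omega)).trans_le (Nat.pow_le_pow_right (by omega)
      (by omega : 2 ≤ 4))
  have h3 : N ^ 3 < (M + 2) ^ 4 :=
    (Nat.pow_lt_pow_left (by omega) (by omega)).trans_le (Nat.pow_le_pow_right (by omega)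
      (by omega : 3 ≤ 4))
  refine ⟨by omega, by simpa using h1, by simpa [pow_succ] using h2, by simpa [pow_succ] using h3⟩

end RAM

theorem mainTheorem6 :
    ∃ (build test : RAM.Prog) (C k : ℕ),
      -- `build`, then `test`, recognizes the graphs whose edge-biclique hypergraph is Helly
      (∀ (n m : ℕ) (G : SimpleGraph (Fin n)) (L : RAM.EdgeList G m),
        ∃ (t : ℕ) (s : RAM.State),
          RAM.Exec ((n + m + 2) ^ k) (RAM.Prog.seq build test) L.input t s ∧
          t ≤ C * (G.edgeSet.ncard ^ 4 + 1) ∧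
          RAM.Answers s G.edgeBicliqueHypergraph.IsHelly) ∧
      -- `build` constructs the biclique line graph
      (∀ (n m : ℕ) (G : SimpleGraph (Fin n)) (L : RAM.EdgeList G m),
        ∃ (t : ℕ) (s : RAM.State),
          RAM.Exec ((n + m + 2) ^ k) build L.input t s ∧
          t ≤ C * (G.edgeSet.ncard ^ 2 + 1) ∧
          RAM.HoldsGraph (G.bicliqueLineGraph.comap L.edge) s) ∧
      -- `test` decides whether the clique hypergraph of a graph is Helly
      (∀ (N : ℕ) (H : SimpleGraph (Fin N)) (s : RAM.State), RAM.HoldsGraph H s →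
        ∃ (t : ℕ) (s' : RAM.State),
          RAM.Exec ((N + 2) ^ k) test s t s' ∧
          t ≤ C * (N ^ 4 + 1) ∧
          RAM.Answers s' H.cliqueHypergraph.IsHelly) := by
  have hbuild : ∀ (n m : ℕ) (G : SimpleGraph (Fin n)) (L : RAM.EdgeList G m),
      RAM.Runs ((n + m + 2) ^ 4) RAM.buildLineGraph L.input (60 * (m ^ 2 + 1))
        (fun s => RAM.HoldsGraph (G.bicliqueLineGraph.comap L.edge) s) := by
    intro n m G L
    obtain ⟨h3, hn, hn2, -⟩ := RAM.lt_add_two_pow_four (Nat.le_add_right n m)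
    obtain ⟨-, hm, hm2, -⟩ := RAM.lt_add_two_pow_four (Nat.le_add_left m n)
    exact RAM.Runs.buildLineGraph L h3 hn hm hn2 hm2
  have htest : ∀ (N : ℕ) (H : SimpleGraph (Fin N)) (s : RAM.State), RAM.HoldsGraph H s →
      RAM.Runs ((N + 2) ^ 4) RAM.cliqueHellyTest s (100 * (N ^ 4 + 1))
        (fun s' => RAM.Answers s' H.cliqueHypergraph.IsHelly) := by
    intro N H s hs
    obtain ⟨h3, hn, hn2, hn3⟩ := RAM.lt_add_two_pow_four (le_refl N)
    exact RAM.Runs.cliqueHellyTest H h3 hn hn2 hn3 hs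
  -- The two time bounds add up to at most `160 * (m ^ 4 + 1)`, so 220 is ample.
  refine ⟨RAM.buildLineGraph, RAM.cliqueHellyTest, 220, 4, ?_, ?_, ?_⟩
  · intro n m G L
    obtain ⟨t₁, s₁, h1, ht₁, hs₁⟩ := hbuild n m G L
    obtain ⟨t₂, s₂, h2, ht₂, hs₂⟩ := htest m _ s₁ hs₁
    refine ⟨t₁ + t₂, s₂, .seq h1 (h2.mono (Nat.pow_le_pow_left (by omega) 4)), ?_, ?_⟩
    · rw [L.ncard_edgeSet]
      have hpow : m ^ 2 ≤ m ^ 4 := by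
        rcases Nat.eq_zero_or_pos m with rfl | hm
        · simp
        · exact Nat.pow_le_pow_right hm (by omega)
      omega
    · rwa [L.isHelly_cliqueHypergraph_iff] at hs₂
  · intro n m G L
    obtain ⟨t, s, h1, ht, hs⟩ := hbuild n m G L
    refine ⟨t, s, h1, ?_, hs⟩
    rw [L.ncard_edgeSet]
    omega
  · intro N H s hs
    obtain ⟨t, s', h1, ht, hs'⟩ := htest N H s hs
    exact ⟨t, s', h1, by omega, hs'⟩
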